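/- Let $\psi(z)=\sum_{n\ge0}b_nz^n$ be a nonconstant power series with $b_n\ge 0$ for all $n$, $b_0>0$ and radius of convergence $R_\psi\in(0,\infty]$. For $t\in(0,R_\psi)$ let $Y_t$ be the random variable with $\mathbb P(Y_t=n)=b_nt^n/\psi(t)$, $n\ge 0$ (the Khinchin family of $\psi$), and let $m(t)=\mathbb E(Y_t)$. Assume $\psi\in\mathcal K^\star$, that is, $\lim_{t\uparrow R_\psi}m(t)>1$ (the limit may be $+\infty$). Then there is a unique $\tau\in(0,R_\psi)$ with $m(\tau)=1$. Put $\rho=\tau/\psi(\tau)$ and $Q_\psi=\gcd\{n>0:b_n>0\}$, and let $G(z,w)=z(\psi(w)-b_0)$, $G_0(z,w)=w$, $G_k(z,w)=G(z,G_{k-1}(z,w))$ for $k\ge1$. For a finite rooted plane tree $a$ let $\#(a)$ be its number of nodes, $\partial(a)$ the minimal distance from the root to a leaf (a node with no descendants; so $\partial=0$ for the one-node tree), and $w_\psi(a)=\prod_{u}b_{d(u)}$ its weight, where the product is over the nodes $u$ of $a$ and $d(u)$ is the number of descendants (children) of $u$. Let $A_n=\sum_{\#(a)=n}w_\psi(a)$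 and $A_n^{(k)}=\sum_{\#(a)=n,\ \partial(a)\ge k}w_\psi(a)$. Fix an integer $k\ge0$. Then $A_n>0$ for all sufficiently large $n\equiv1 \pmod{Q_\psi}$, the derivative $\frac{\partial G_k}{\partial w}(\rho,\tau)$ exists, and $$\lim_{\substack{n\to\infty\\ n\equiv1\,(\mathrm{mod}\ Q_\psi)}}\frac{A_n^{(k)}}{A_n}=\frac{\partial G_k}{\partial w}(\rho,\tau).$$ Moreover, for every $t\in(0,R_\psi)$, if $T_t$ is the Galton–Watson tree (a random, possibly infinite, rooted plane tree) with offspring distribution $Y_t$, then $\mathbb P(\#(T_t)=n)>0$ for all sufficiently large $n\equiv1\pmod{Q_\psi}$; for every $n$ with $\mathbb P(\#(T_t)=n)>0$ we have $A_n>0$ and $$\mathbb P\big(\partial(T_t)\ge k\,\big|\,\#(T_t)=n\big)=\frac{A_n^{(k)}}{A_n};$$ and consequently $$\lim_{\substack{n\to\infty\\ n\equiv1\,(\mathrm{mod}\ Q_\psi)}}\mathbb P\big(\partial(T_t)\ge k\,\big|\,\#(T_t)=n\big)=\frac{\partial G_k}{\partial w}(\rho,\tau).$$ -/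

import Mathlib

open Filter Topology MeasureTheory ProbabilityTheory
open scoped ENNReal NNReal

noncomputable section

namespace GWBorder

/-! ### Power series with nonnegative coefficients and Khinchin families -/

/-- The radius of convergence `R_ψ ∈ [0, ∞]` of a real power series. -/
def radius (ψ : PowerSeries ℝ) : ℝ≥0∞ :=
  (FormalMultilinearSeries.ofScalars ℝ (fun n => PowerSeries.coeff n ψ)).radius

/-- The sum `ψ(z) = ∑ bₙ zⁿ` at a real or complex point `z` (used only inside the open disk of
convergence, where the series converges absolutely). -/
def value {𝕜 : Type*} [RCLike 𝕜] (ψ : PowerSeries ℝ) (z : 𝕜) : 𝕜 :=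
  ∑' n : ℕ, ((PowerSeries.coeff n ψ : ℝ) : 𝕜) * z ^ n

/-- The class `𝒦`: nonconstant power series with nonnegative coefficients, positive radius of
convergence and positive constant term. -/
structure IsK (ψ : PowerSeries ℝ) : Prop where
  coeff_nonneg : ∀ n, 0 ≤ PowerSeries.coeff n ψ
  coeff_zero_pos : 0 < PowerSeries.coeff 0 ψ
  nonconstant : ∃ n, 1 ≤ n ∧ PowerSeries.coeff n ψ ≠ 0
  radius_pos : 0 < radius ψ

/-- The probability `bₙ tⁿ / ψ(t)` that the Khinchin variable `Y_t` of `ψ` takes the value `n`. -/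
def khinchinProb (ψ : PowerSeries ℝ) (t : ℝ) (n : ℕ) : ℝ :=
  PowerSeries.coeff n ψ * t ^ n / value ψ t

/-- The mean `m(t) = E(Y_t)` of the Khinchin variable. -/
def mean (ψ : PowerSeries ℝ) (t : ℝ) : ℝ :=
  ∑' n : ℕ, (n : ℝ) * khinchinProb ψ t n

/-- The class `𝒦*`: those `ψ ∈ 𝒦` for which `lim_{t ↑ R_ψ} m(t) > 1`. The radius and the limit
may be infinite. -/
structure IsKStar (ψ : PowerSeries ℝ) : Prop extends IsK ψ where
  one_lt_lim : ∃ L : EReal, 1 < L ∧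
    Tendsto (fun t : ℝ≥0 => ((mean ψ (t : ℝ) : ℝ) : EReal))
      (comap (fun t : ℝ≥0 => (t : ℝ≥0∞)) (𝓝[<] radius ψ)) (𝓝 L)

/-- `τ` is an apex of `ψ`: `τ ∈ (0, R_ψ)` and `m(τ) = 1`. -/
structure IsApex (ψ : PowerSeries ℝ) (τ : ℝ) : Prop where
  pos : 0 < τ
  lt_radius : ENNReal.ofReal τ < radius ψ
  mean_eq_one : mean ψ τ = 1

/-- `Q_ψ`, the greatest common divisor of `{n > 0 : bₙ > 0}`. -/
def period (ψ : PowerSeries ℝ) : ℕ :=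
  sSup {d : ℕ | ∀ n : ℕ, 0 < n → 0 < PowerSeries.coeff n ψ → d ∣ n}

/-- `G(z, w) = z (ψ(w) - b₀)`. -/
def G (ψ : PowerSeries ℝ) (z w : ℂ) : ℂ :=
  z * (value ψ w - ((PowerSeries.coeff 0 ψ : ℝ) : ℂ))

/-- The `k`-th iterate `G_k` of `G` in the second variable. -/
def GIter (ψ : PowerSeries ℝ) : ℕ → ℂ → ℂ → ℂ
  | 0, _, w => w
  | k + 1, z, w => G ψ z (GIter ψ k z w)

/-! ### Rooted plane trees

Nodes are words of natural numbers: the root is the empty word and the children of `u` are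
`u ++ [0], u ++ [1], …`, from left to right. -/

/-- `T` is the node set of a rooted plane tree. -/
structure IsPlaneTree (T : Set (List ℕ)) : Prop where
  root_mem : [] ∈ T
  parent_mem : ∀ u i, u ++ [i] ∈ T → u ∈ T
  sibling_mem : ∀ u i j, j ≤ i → u ++ [i] ∈ T → u ++ [j] ∈ T

/-- The number of children of `u` in `T`. -/
def outdegree (T : Set (List ℕ)) (u : List ℕ) : ℕ :=
  Set.ncard {i : ℕ | u ++ [i] ∈ T}

/-- The leaves of `T`: the nodes without children. -/
def leaves (T : Set (List ℕ)) : Set (List ℕ) :=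
  {u | u ∈ T ∧ ∀ i, u ++ [i] ∉ T}

/-- The distance `∂(T)` to the border: the minimal distance from the root to a leaf
(`∞` if there are no leaves). -/
def borderDist (T : Set (List ℕ)) : ℕ∞ :=
  ⨅ u ∈ leaves T, (u.length : ℕ∞)

lemma IsPlaneTree.prefix_mem {T : Set (List ℕ)} (h : IsPlaneTree T) (u v : List ℕ)
    (huv : u ++ v ∈ T) : u ∈ T := by
  induction v using List.reverseRecOn with
  | nil => simpa using huv
  | append_singleton w i ih =>
    exact ih (h.parent_mem (u ++ w) i (by simpa [List.append_assoc] using huv))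

lemma finite_planeTrees (n : ℕ) :
    {a : Finset (List ℕ) | IsPlaneTree (a : Set (List ℕ)) ∧ a.card = n}.Finite := by
  have hS : {u : List ℕ | u.length < n ∧ ∀ i ∈ u, i < n}.Finite := by
    refine ((List.finite_length_lt (Fin n) n).image (List.map Fin.val)).subset ?_
    rintro u ⟨hu, hi⟩
    refine ⟨u.pmap (fun i hi => (⟨i, hi⟩ : Fin n)) hi, by simpa using hu, ?_⟩
    simp [List.map_pmap]
  refine (Finset.finite_toSet hS.toFinset.powerset).subset ?_
  rintro a ⟨ha, hc⟩
  simp only [Finset.coe_powerset, Set.mem_preimage, Set.mem_powerset_iff]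
  intro u hu
  simp only [Set.Finite.coe_toFinset, Set.mem_ofPred_eq]
  constructor
  · have : (Finset.range (u.length + 1)).card ≤ a.card := by
      refine Finset.card_le_card_of_injOn (fun j => u.take j) ?_ ?_
      · intro j _
        exact ha.prefix_mem (u.take j) (u.drop j) (by simpa using hu)
      · intro i hi j hj hij
        have h1 := congrArg List.length hij
        simp only [Finset.coe_range, Set.mem_Iio] at hi hj
        simp only [List.length_take] at h1
        omega
    rw [Finset.card_range] at this
    omega
  · intro i hi
    obtain ⟨v, w, rfl⟩ := List.append_of_mem hi
    have hv : v ++ [i] ∈ (a : Set (List ℕ)) :=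
      ha.prefix_mem (v ++ [i]) w (by simpa using hu)
    have : (Finset.range (i + 1)).card ≤ a.card := by
      refine Finset.card_le_card_of_injOn (fun j => v ++ [j]) ?_ ?_
      · intro j hj
        simp only [Finset.coe_range, Set.mem_Iio] at hj
        exact ha.sibling_mem v i j (by omega) hv
      · intro j _ l _ hjl
        simpa using hjl
    rw [Finset.card_range] at this
    omega

/-- The finite set of rooted plane trees with `n` nodes. -/
def planeTrees (n : ℕ) : Finset (Finset (List ℕ)) :=
  (finite_planeTrees n).toFinset

/-- The weight of a finite tree: the product over its nodes of `b_j`, `j` the outdegree of the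
node, that is, `∏ⱼ bⱼ ^ kⱼ` with `kⱼ` the number of nodes of outdegree `j`. -/
def weight (ψ : PowerSeries ℝ) (a : Finset (List ℕ)) : ℝ :=
  ∏ u ∈ a, PowerSeries.coeff (outdegree (a : Set (List ℕ)) u) ψ

/-- `Aₙ`: the total weight of the rooted plane trees with `n` nodes. -/
def A (ψ : PowerSeries ℝ) (n : ℕ) : ℝ :=
  ∑ a ∈ planeTrees n, weight ψ a

open Classical in
/-- `Aₙ⁽ᵏ⁾`: the total weight of the rooted plane trees with `n` nodes and `∂ ≥ k`. -/
def ABorder (ψ : PowerSeries ℝ) (k n : ℕ) : ℝ :=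
  ∑ a ∈ (planeTrees n).filter (fun a : Finset (List ℕ) => (k : ℕ∞) ≤ borderDist (a : Set (List ℕ))), weight ψ a

/-! ### Galton–Watson trees -/

/-- The plane tree in which the potential individual `u` has `N u` children: a word belongs to it
if along its genealogy each individual is one of the children of its parent. -/
def treeOf (N : List ℕ → ℕ) : Set (List ℕ) :=
  {u | ∀ v i, (v ++ [i]) <+: u → i < N v}

/-- The variables `N u` (`u` a word) are i.i.d. copies of the Khinchin variable `Y_t` of `ψ`;
then `ω ↦ treeOf (fun u => N u ω)` is the Galton–Watson tree `T_t`. -/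
structure IsKhinchinOffspring (ψ : PowerSeries ℝ) (t : ℝ) {Ω : Type*} [MeasurableSpace Ω]
    (μ : Measure Ω) (N : List ℕ → Ω → ℕ) : Prop where
  measurable : ∀ u, Measurable (N u)
  indep : iIndepFun N μ
  law : ∀ u n, μ.real {ω | N u ω = n} = khinchinProb ψ t n

/-- The event `#(T) = n`. -/
def sizeEvent {Ω : Type*} (N : List ℕ → Ω → ℕ) (n : ℕ) : Set Ω :=
  {ω | (treeOf fun u => N u ω).encard = n}

/-- The event `∂(T) ≥ k`. -/
def borderEvent {Ω : Type*} (N : List ℕ → Ω → ℕ) (k : ℕ) : Set Ω :=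
  {ω | (k : ℕ∞) ≤ borderDist (treeOf fun u => N u ω)}

/-- `n → ∞` along `n ≡ 1 mod Q_ψ`. -/
def alongOne (ψ : PowerSeries ℝ) : Filter ℕ :=
  atTop ⊓ 𝓟 {n : ℕ | n ≡ 1 [MOD period ψ]}

end GWBorder

end

/-!
Removing the root turns a plane tree into the tuple of its subtrees, so the series
`T_k(z) = ∑ Aₙ⁽ᵏ⁾ zⁿ` satisfy `T_0 = T = z ψ(T)` and `T_{k+1} = z (ψ(T_k) - b₀) = G(z, T_k)`
(`A_succ`, `ABorder_succ`); hence `T_k(z) = G_k(z, T(z))`, and the assertion is that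
`[zⁿ] G_k(z, T(z)) / [zⁿ] T(z)` tends to `∂G_k/∂w (ρ, τ)`. The proof uses no singularity analysis
and has two parts.

*The size of `Aₙ`.* Lagrange's formula `Aₙ = (1/n) [w^{n-1}] ψⁿ` (`lagrange_pow`, `succ_mul_A_succ`)
reads `Aₙ ρⁿ = (τ/n) P(Sₙ = n - 1)`, where `Sₙ` is a sum of `n` independent copies of the Khinchin
variable `Y_τ`, of mean `1`. A local limit theorem (`exists_tendsto_sqrt_mul_coeff_pow`) then gives
`Aₙ ρⁿ ~ κ n^{-3/2}` with `κ > 0` along `n ≡ 1 (mod Q_ψ)`. It is proved by Fourier inversion and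
dominated convergence; the Gaussian domination of the characteristic function `φ` comes from the
fact that the integers `l` with `|e^{ilθ} - 1|² ≤ C (1 - |φ(θ)|)` for some `C` form a subgroup of
`ℤ` which contains the support of `Y_τ`, hence `Q_ψ`.

*Transfer to `Aₙ⁽ᵏ⁾`.* Sequences with nonnegative terms, sum `s` and tail `c n^{-3/2}` along a
residue class are stable under convolution (`HasTail.mul`), since the convolution is dominated by
the terms in which one index stays bounded and the other one carries the tail. A bound for
convolution powers that is uniform up to a polynomial factor (`HasTail.exists_bound_pow`) extends
this to composition with `ψ`, which multiplies the tail by the derivative (`HasTail.comp`). So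
`Aₙ⁽ᵏ⁾ ρⁿ` has the sum `t_k = G_k(ρ, τ)` and the tail `D_k κ n^{-3/2}` with `D_{k+1} = ρ ψ'(t_k) D_k`,
which is the recursion that the chain rule gives for `∂G_k/∂w (ρ, τ)`. The induction starts from
`T(ρ) = τ`: the graph of `ψ` lies strictly above its tangent at `τ`, so `τ` is the only solution of
`s = ρ ψ(s)` (`lt_value_of_isApex`).

Finally, the Galton–Watson tree equals a given tree with `n` nodes with probability the weight of
the tree times `t^{n-1} / ψ(t)ⁿ`, a factor that depends on `n` alone (`measureReal_treeEvent`) and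
cancels in the conditional probability.
-/

namespace GWBorder

variable {ψ : PowerSeries ℝ}

/-! ### Convergence inside the disk, and the apex -/

lemma value_real (ψ : PowerSeries ℝ) (x : ℝ) :
    value ψ x = ∑' n : ℕ, PowerSeries.coeff n ψ * x ^ n := by
  simp [value]

lemma value_ofReal (ψ : PowerSeries ℝ) (x : ℝ) :
    value ψ (x : ℂ) = ((value ψ x : ℝ) : ℂ) := by
  simp [value, Complex.ofReal_tsum]

lemma exists_lt_radius {t : ℝ} (ht0 : 0 ≤ t) (ht : ENNReal.ofReal t < radius ψ) :
    ∃ r : ℝ, t < r ∧ ENNReal.ofReal r < radius ψ := by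
  obtain ⟨r, h1, h2⟩ := ENNReal.lt_iff_exists_nnreal_btwn.1 ht
  refine ⟨r, ?_, by simpa using h2⟩
  have h3 := (ENNReal.ofReal_lt_iff_lt_toReal ht0 (by simp)).1 h1
  simpa using h3

lemma summable_coeff_mul_pow (hψ : IsK ψ) {t : ℝ} (ht0 : 0 ≤ t)
    (ht : ENNReal.ofReal t < radius ψ) :
    Summable fun n : ℕ => PowerSeries.coeff n ψ * t ^ n := by
  have h := FormalMultilinearSeries.summable_norm_mul_pow
    (FormalMultilinearSeries.ofScalars ℝ (fun n => PowerSeries.coeff n ψ)) (r := t.toNNReal) ht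
  refine h.congr fun n => ?_
  rw [FormalMultilinearSeries.ofScalars_norm, Real.norm_of_nonneg (hψ.coeff_nonneg n),
    Real.coe_toNNReal _ ht0]

/-- All polynomial moments converge strictly inside the disk of convergence. -/
lemma summable_pow_mul_coeff_mul_pow (hψ : IsK ψ) (k : ℕ) {t : ℝ} (ht0 : 0 ≤ t)
    (ht : ENNReal.ofReal t < radius ψ) :
    Summable fun n : ℕ => (n : ℝ) ^ k * (PowerSeries.coeff n ψ * t ^ n) := by
  obtain ⟨r, htr, hr⟩ := exists_lt_radius ht0 ht
  have hr0 : 0 < r := ht0.trans_lt htr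
  have hs := summable_coeff_mul_pow hψ hr0.le hr
  have hq : ‖t / r‖ < 1 := by
    rw [Real.norm_of_nonneg (by positivity)]
    exact (div_lt_one hr0).2 htr
  refine Summable.of_nonneg_of_le (fun n => ?_) (fun n => ?_)
    ((summable_pow_mul_geometric_of_norm_lt_one k hq).mul_right
      (∑' n : ℕ, PowerSeries.coeff n ψ * r ^ n))
  · have := hψ.coeff_nonneg n
    positivity
  · have h1 : PowerSeries.coeff n ψ * r ^ n ≤ ∑' n : ℕ, PowerSeries.coeff n ψ * r ^ n :=
      hs.le_tsum n fun m _ => mul_nonneg (hψ.coeff_nonneg m) (by positivity)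
    have h2 : (n : ℝ) ^ k * (PowerSeries.coeff n ψ * t ^ n) =
        (n : ℝ) ^ k * (t / r) ^ n * (PowerSeries.coeff n ψ * r ^ n) := by
      rw [div_pow]
      field_simp
    rw [h2]
    gcongr

lemma summable_mul_coeff_mul_pow (hψ : IsK ψ) {t : ℝ} (ht0 : 0 ≤ t)
    (ht : ENNReal.ofReal t < radius ψ) :
    Summable fun n : ℕ => (n : ℝ) * (PowerSeries.coeff n ψ * t ^ n) := by
  simpa using summable_pow_mul_coeff_mul_pow hψ 1 ht0 ht

lemma value_pos (hψ : IsK ψ) {t : ℝ} (ht0 : 0 ≤ t) (ht : ENNReal.ofReal t < radius ψ) :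
    0 < value ψ t := by
  rw [value_real]
  refine (summable_coeff_mul_pow hψ ht0 ht).tsum_pos
    (fun n => mul_nonneg (hψ.coeff_nonneg n) (by positivity)) 0 ?_
  simpa using hψ.coeff_zero_pos

lemma mean_eq (ψ : PowerSeries ℝ) (t : ℝ) :
    mean ψ t = (∑' n : ℕ, (n : ℝ) * (PowerSeries.coeff n ψ * t ^ n)) / value ψ t := by
  rw [mean, ← tsum_div_const]
  refine tsum_congr fun n => ?_
  rw [khinchinProb]
  ring

/-- The sum `t ψ'(t) - ψ(t)`, whose sign is that of `m(t) - 1`. -/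
lemma tsum_sub_one_mul (hψ : IsK ψ) {t : ℝ} (ht0 : 0 ≤ t) (ht : ENNReal.ofReal t < radius ψ) :
    ∑' n : ℕ, ((n : ℝ) - 1) * (PowerSeries.coeff n ψ * t ^ n) =
      (mean ψ t - 1) * value ψ t := by
  have h : ∀ n : ℕ, ((n : ℝ) - 1) * (PowerSeries.coeff n ψ * t ^ n) =
      (n : ℝ) * (PowerSeries.coeff n ψ * t ^ n) - PowerSeries.coeff n ψ * t ^ n := fun n => by ring
  simp_rw [h]
  rw [(summable_mul_coeff_mul_pow hψ ht0 ht).tsum_sub (summable_coeff_mul_pow hψ ht0 ht),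
    mean_eq, sub_mul, div_mul_cancel₀ _ (value_pos hψ ht0 ht).ne', one_mul, ← value_real]

/-- The filter in the definition of `𝒦*` is nontrivial, so the limit of the mean is approached. -/
lemma exists_one_lt_mean (hψ : IsKStar ψ) :
    ∃ t : ℝ, 0 ≤ t ∧ ENNReal.ofReal t < radius ψ ∧ 1 < mean ψ t := by
  obtain ⟨L, hL, hlim⟩ := hψ.one_lt_lim
  have hne : (comap (fun t : ℝ≥0 => (t : ℝ≥0∞)) (𝓝[<] radius ψ)).NeBot := by
    refine comap_neBot fun s hs => ?_
    obtain ⟨a, ha, has⟩ := (mem_nhdsLT_iff_exists_Ioo_subset' hψ.radius_pos).1 hs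
    obtain ⟨r, h1, h2⟩ := ENNReal.lt_iff_exists_nnreal_btwn.1 ha
    exact ⟨r, has ⟨h1, h2⟩⟩
  have h1 := hlim.eventually (lt_mem_nhds hL)
  have h2 : ∀ᶠ t : ℝ≥0 in comap (fun t : ℝ≥0 => (t : ℝ≥0∞)) (𝓝[<] radius ψ),
      (t : ℝ≥0∞) < radius ψ :=
    Eventually.comap (p := fun x : ℝ≥0∞ => x < radius ψ) self_mem_nhdsWithin _
  obtain ⟨t, ht1, ht2⟩ := (h1.and h2).exists
  exact ⟨t, t.2, by simpa using ht2, by exact_mod_cast ht1⟩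

/-- The function `t ψ'(t) - ψ(t)` is negative at `0` and positive where `m > 1`; it vanishes in
between, and there `m = 1`. -/
lemma exists_isApex (hψ : IsKStar ψ) : ∃ τ, IsApex ψ τ := by
  have hK := hψ.toIsK
  obtain ⟨t, ht0, ht, hm⟩ := exists_one_lt_mean hψ
  set g : ℝ → ℝ := fun x => ∑' n : ℕ, ((n : ℝ) - 1) * (PowerSeries.coeff n ψ * x ^ n) with hg
  have hcont : ContinuousOn g (Set.Icc 0 t) := by
    refine continuousOn_tsum (u := fun n : ℕ => (n : ℝ) * (PowerSeries.coeff n ψ * t ^ n) +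
      PowerSeries.coeff n ψ * t ^ n) (fun n => by fun_prop)
      ((summable_mul_coeff_mul_pow hK ht0 ht).add (summable_coeff_mul_pow hK ht0 ht)) ?_
    intro n x hx
    have hb := hK.coeff_nonneg n
    have h1 : |(n : ℝ) - 1| ≤ n + 1 := by
      rw [abs_le]
      constructor <;> linarith [(Nat.cast_nonneg n : (0 : ℝ) ≤ n)]
    have h2 : PowerSeries.coeff n ψ * x ^ n ≤ PowerSeries.coeff n ψ * t ^ n := by
      have := hx.1
      have := hx.2
      gcongr
    have h3 : 0 ≤ PowerSeries.coeff n ψ * x ^ n := mul_nonneg hb (pow_nonneg hx.1 n)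
    rw [Real.norm_eq_abs, abs_mul, abs_of_nonneg h3]
    calc |(n : ℝ) - 1| * (PowerSeries.coeff n ψ * x ^ n)
        ≤ (n + 1) * (PowerSeries.coeff n ψ * t ^ n) := by gcongr
      _ = _ := by ring
  have h0 : g 0 < 0 := by
    have : g 0 = - PowerSeries.coeff 0 ψ := by
      rw [hg]
      dsimp only
      rw [tsum_eq_single 0 (fun n hn => by simp [hn])]
      simp
    linarith [hK.coeff_zero_pos]
  have h1 : 0 < g t := by
    rw [hg]
    dsimp only
    rw [tsum_sub_one_mul hK ht0 ht]
    exact mul_pos (by linarith) (value_pos hK ht0 ht)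
  obtain ⟨τ, hτ, hτ0⟩ := intermediate_value_Icc ht0 hcont ⟨h0.le, h1.le⟩
  have hτr : ENNReal.ofReal τ < radius ψ := (ENNReal.ofReal_le_ofReal hτ.2).trans_lt ht
  refine ⟨τ, ?_, hτr, ?_⟩
  · refine lt_of_le_of_ne hτ.1 fun h => ?_
    rw [← h] at hτ0
    exact h0.ne hτ0
  · have := tsum_sub_one_mul hK hτ.1 hτr
    rw [hg] at hτ0
    dsimp only at hτ0
    rw [hτ0] at this
    rcases mul_eq_zero.1 this.symm with h | h
    · linarith
    · exact absurd h (value_pos hK hτ.1 hτr).ne'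

/-- A mean equal to `1` with `b₀ > 0` forces some `bₙ > 0` with `n ≥ 2`. -/
lemma exists_two_le_coeff_pos (hψ : IsK ψ) {τ : ℝ} (hτ : IsApex ψ τ) :
    ∃ n, 2 ≤ n ∧ 0 < PowerSeries.coeff n ψ := by
  by_contra! h
  have h1 := tsum_sub_one_mul hψ hτ.pos.le hτ.lt_radius
  rw [hτ.mean_eq_one, sub_self, zero_mul, tsum_eq_single 0] at h1
  · simp only [Nat.cast_zero, zero_sub, pow_zero, mul_one, neg_mul, one_mul, neg_eq_zero] at h1
    exact hψ.coeff_zero_pos.ne' h1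
  · intro n hn
    rcases Nat.lt_or_ge n 2 with h2 | h2
    · obtain rfl : n = 1 := by omega
      simp
    · rw [le_antisymm (h n h2) (hψ.coeff_nonneg n)]
      simp

/-- Bernoulli's inequality, averaged over the Khinchin variable `Y_τ` of mean `1`: the graph of
`ψ` lies strictly above its tangent at the apex, which passes through the origin. -/
lemma lt_value_of_isApex (hψ : IsK ψ) {τ x : ℝ} (hτ : IsApex ψ τ) (hx0 : 0 ≤ x)
    (hx : ENNReal.ofReal x < radius ψ) (hne : x ≠ τ) :
    x / τ * value ψ τ < value ψ x := by
  obtain ⟨m, hm2, hm⟩ := exists_two_le_coeff_pos hψ hτ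
  have hτ0 := hτ.pos
  -- Bernoulli: `r ^ n ≥ 1 + n (r - 1) = r + (n - 1) (r - 1)`, strictly for `n ≥ 2`, and the terms
  -- with the factor `n - 1` sum to zero because the mean is `1`.
  set r := x / τ with hr
  have hr0 : 0 ≤ r := by positivity
  have hr1 : r ≠ 1 := fun h => hne (by rw [hr, div_eq_one_iff_eq hτ0.ne'] at h; exact h)
  have hxr : x = r * τ := by rw [hr]; field_simp
  have hS := summable_coeff_mul_pow hψ hτ0.le hτ.lt_radius
  have hS1 : Summable fun n : ℕ => ((n : ℝ) - 1) * (PowerSeries.coeff n ψ * τ ^ n) := by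
    refine ((summable_mul_coeff_mul_pow hψ hτ0.le hτ.lt_radius).sub hS).congr fun n => by ring
  have key : ∑' n : ℕ, (r * (PowerSeries.coeff n ψ * τ ^ n) +
      (r - 1) * (((n : ℝ) - 1) * (PowerSeries.coeff n ψ * τ ^ n))) <
      ∑' n : ℕ, PowerSeries.coeff n ψ * x ^ n := by
    have e : ∀ n : ℕ, r * (PowerSeries.coeff n ψ * τ ^ n) +
      (r - 1) * (((n : ℝ) - 1) * (PowerSeries.coeff n ψ * τ ^ n)) =
      (1 + n * (r - 1)) * (PowerSeries.coeff n ψ * τ ^ n) := fun n => by ring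
    have e2 : ∀ n : ℕ, PowerSeries.coeff n ψ * x ^ n = r ^ n * (PowerSeries.coeff n ψ * τ ^ n) :=
      fun n => by rw [hxr, mul_pow]; ring
    refine Summable.tsum_lt_tsum (i := m) (fun n => ?_) ?_ ((hS.mul_left _).add (hS1.mul_left _))
      (summable_coeff_mul_pow hψ hx0 hx)
    · have := hψ.coeff_nonneg n
      rw [e, e2]
      gcongr
      have := one_add_mul_le_pow (a := r - 1) (by linarith) n
      simpa using this
    · rw [e, e2]
      have h2 := one_add_mul_self_lt_rpow_one_add (s := r - 1) (by linarith)
        (sub_ne_zero.2 hr1) (p := (m : ℝ)) (by exact_mod_cast hm2)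
      rw [add_sub_cancel, Real.rpow_natCast] at h2
      have : 0 < PowerSeries.coeff m ψ * τ ^ m := by positivity
      exact mul_lt_mul_of_pos_right h2 this
  rw [(hS.mul_left _).tsum_add (hS1.mul_left _), tsum_mul_left, tsum_mul_left,
    tsum_sub_one_mul hψ hτ0.le hτ.lt_radius, hτ.mean_eq_one, sub_self, zero_mul, mul_zero,
    add_zero, ← value_real, ← value_real] at key
  exact key

lemma isApex_unique (hψ : IsK ψ) {τ τ' : ℝ} (hτ : IsApex ψ τ) (hτ' : IsApex ψ τ') : τ' = τ := by
  by_contra hne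
  have h1 := lt_value_of_isApex hψ hτ hτ'.pos.le hτ'.lt_radius hne
  have h2 := lt_value_of_isApex hψ hτ' hτ.pos.le hτ.lt_radius (Ne.symm hne)
  have := hτ.pos
  have := hτ'.pos
  rw [div_mul_eq_mul_div, div_lt_iff₀ (by assumption)] at h1 h2
  linarith

/-- Termwise differentiation of `ψ`, at a real point of the disk of convergence. -/
lemma hasDerivAt_value (hψ : IsK ψ) {x : ℝ} (hx0 : 0 ≤ x) (hx : ENNReal.ofReal x < radius ψ) :
    HasDerivAt (fun w : ℂ => value ψ w)
      ((∑' n : ℕ, PowerSeries.coeff n ψ * (n * x ^ (n - 1)) : ℝ) : ℂ) (x : ℂ) := by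
  obtain ⟨r, hxr, hr⟩ := exists_lt_radius hx0 hx
  have hr0 : 0 < r := hx0.trans_lt hxr
  have hxm : (x : ℂ) ∈ Metric.ball (0 : ℂ) r := by
    simpa [abs_of_nonneg hx0] using hxr
  have hu : Summable fun n : ℕ => PowerSeries.coeff n ψ * (n * r ^ (n - 1)) := by
    refine ((summable_mul_coeff_mul_pow hψ hr0.le hr).mul_left r⁻¹).congr fun n => ?_
    rcases n with _ | n
    · simp
    · rw [Nat.add_sub_cancel, pow_succ]
      field_simp
  have h := hasDerivAt_tsum_of_isPreconnected (𝕜 := ℂ) hu Metric.isOpen_ball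
    (convex_ball (0 : ℂ) r).isPreconnected
    (g := fun n w => ((PowerSeries.coeff n ψ : ℝ) : ℂ) * w ^ n)
    (g' := fun n w => ((PowerSeries.coeff n ψ : ℝ) : ℂ) * (n * w ^ (n - 1)))
    (fun n y _ => (hasDerivAt_pow n y).const_mul _) ?_ hxm ?_ hxm
  · rw [show ((∑' n : ℕ, PowerSeries.coeff n ψ * (n * x ^ (n - 1)) : ℝ) : ℂ) =
      ∑' n : ℕ, ((PowerSeries.coeff n ψ : ℝ) : ℂ) * (n * (x : ℂ) ^ (n - 1)) by
        push_cast
        rfl]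
    exact h
  · intro n y hy
    have hy' : ‖y‖ ≤ r := by simpa using (mem_ball_zero_iff.1 hy).le
    rw [norm_mul, norm_mul, norm_pow, Complex.norm_real, Real.norm_of_nonneg (hψ.coeff_nonneg n),
      Complex.norm_natCast]
    have := hψ.coeff_nonneg n
    gcongr
  · refine Summable.of_norm ((summable_coeff_mul_pow hψ hx0 hx).congr fun n => ?_)
    simp [abs_of_nonneg hx0, abs_of_nonneg (hψ.coeff_nonneg n)]

/-! ### Decomposition of a plane tree at its root -/

lemma mem_planeTrees {n : ℕ} {a : Finset (List ℕ)} :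
    a ∈ planeTrees n ↔ IsPlaneTree (a : Set (List ℕ)) ∧ a.card = n := by
  simp [planeTrees]

/-- The children of a node are numbered `0, 1, …` without gaps. -/
lemma IsPlaneTree.append_mem_iff {T : Set (List ℕ)} (hT : IsPlaneTree T) (hfin : T.Finite)
    (u : List ℕ) (i : ℕ) : u ++ [i] ∈ T ↔ i < outdegree T u := by
  have hS : {i : ℕ | u ++ [i] ∈ T}.Finite :=
    hfin.preimage (f := fun i => u ++ [i]) (fun i _ j _ h => by simpa using h)
  constructor
  · intro h
    have h1 : Set.Iio (i + 1) ⊆ {i : ℕ | u ++ [i] ∈ T} := fun j hj =>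
      hT.sibling_mem u i j (Nat.lt_succ_iff.1 hj) h
    have h2 := Set.ncard_le_ncard h1 hS
    rw [Set.ncard_Iio_nat] at h2
    exact h2
  · intro h
    by_contra hi
    have h1 : {i : ℕ | u ++ [i] ∈ T} ⊆ Set.Iio i := fun j hj => by
      by_contra hij
      exact hi (hT.sibling_mem u j i (by simpa using hij) hj)
    have h2 := Set.ncard_le_ncard h1 (Set.finite_Iio i)
    rw [Set.ncard_Iio_nat] at h2
    exact absurd h (not_lt.2 h2)

/-- The nodes of `a` above the `i`-th child of the root, read from that child: a plane tree if the
root has more than `i` children, and the empty set otherwise. -/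
noncomputable def subtree (i : ℕ) (a : Finset (List ℕ)) : Finset (List ℕ) :=
  a.preimage (List.cons i) List.cons_injective.injOn

@[simp] lemma mem_subtree {i : ℕ} {a : Finset (List ℕ)} {u : List ℕ} :
    u ∈ subtree i a ↔ i :: u ∈ a := by
  simp [subtree]

/-- The tree whose root has `d` children carrying the trees `f 0, …, f (d - 1)`. -/
def graft {d : ℕ} (f : Fin d → Finset (List ℕ)) : Finset (List ℕ) :=
  insert [] (Finset.univ.biUnion fun i => (f i).image (List.cons (i : ℕ)))

section Graft

variable {d : ℕ} {f : Fin d → Finset (List ℕ)}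

@[simp] lemma nil_mem_graft : [] ∈ graft f := by
  simp [graft]

lemma cons_mem_graft {j : ℕ} {u : List ℕ} :
    j :: u ∈ graft f ↔ ∃ h : j < d, u ∈ f ⟨j, h⟩ := by
  simp only [graft, Finset.mem_insert, reduceCtorEq, Finset.mem_biUnion, Finset.mem_univ,
    Finset.mem_image, true_and, false_or, List.cons.injEq]
  constructor
  · rintro ⟨i, v, hv, rfl, rfl⟩
    exact ⟨i.2, hv⟩
  · rintro ⟨h, hu⟩
    exact ⟨⟨j, h⟩, u, hu, rfl, rfl⟩

@[simp] lemma fin_cons_mem_graft {j : Fin d} {u : List ℕ} : (j : ℕ) :: u ∈ graft f ↔ u ∈ f j := by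
  simp [cons_mem_graft]

/-- Products over the nodes of a grafted tree split at the root. -/
lemma prod_graft {M : Type*} [CommMonoid M] (g : List ℕ → M) :
    ∏ u ∈ graft f, g u = g [] * ∏ i, ∏ u ∈ f i, g ((i : ℕ) :: u) := by
  rw [graft, Finset.prod_insert (by simp), Finset.prod_biUnion]
  · congr 1
    refine Finset.prod_congr rfl fun i _ => ?_
    rw [Finset.prod_image (fun _ _ _ _ h => List.cons_injective h)]
  · intro i _ j _ hij
    refine Finset.disjoint_left.2 fun u hu hv => hij ?_
    obtain ⟨v, -, rfl⟩ := Finset.mem_image.1 hu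
    obtain ⟨w, -, hw⟩ := Finset.mem_image.1 hv
    exact Fin.ext (List.cons.inj hw).1.symm

lemma card_graft : (graft f).card = (∑ i, (f i).card) + 1 := by
  have h := prod_graft (f := f) (fun _ => Multiplicative.ofAdd (1 : ℕ))
  have h2 := congrArg Multiplicative.toAdd h
  simpa [toAdd_prod, add_comm] using h2

lemma outdegree_graft_cons (i : Fin d) (u : List ℕ) :
    outdegree (graft f : Set (List ℕ)) ((i : ℕ) :: u) = outdegree (f i : Set (List ℕ)) u := by
  simp [outdegree]

lemma isPlaneTree_graft (hf : ∀ i, IsPlaneTree (f i : Set (List ℕ))) :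
    IsPlaneTree (graft f : Set (List ℕ)) where
  root_mem := by simp
  parent_mem := by
    rintro (_ | ⟨j, u⟩) i h
    · simp
    · simp only [List.cons_append, Finset.mem_coe, cons_mem_graft] at h ⊢
      exact h.imp fun hj hu => (hf ⟨j, hj⟩).parent_mem u i hu
  sibling_mem := by
    rintro (_ | ⟨k, u⟩) i j hij h
    · simp only [List.nil_append, Finset.mem_coe, cons_mem_graft] at h ⊢
      obtain ⟨hi, -⟩ := h
      exact ⟨hij.trans_lt hi, (hf _).root_mem⟩
    · simp only [List.cons_append, Finset.mem_coe, cons_mem_graft] at h ⊢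
      exact h.imp fun hj hu => (hf ⟨k, hj⟩).sibling_mem u i j hij hu

lemma outdegree_graft_nil (hf : ∀ i, IsPlaneTree (f i : Set (List ℕ))) :
    outdegree (graft f : Set (List ℕ)) [] = d := by
  have : {i : ℕ | [] ++ [i] ∈ (graft f : Set (List ℕ))} = Set.Iio d := by
    ext i
    simp only [List.nil_append, Finset.mem_coe, cons_mem_graft, Set.mem_ofPred_eq, Set.mem_Iio]
    exact ⟨fun h => h.1, fun h => ⟨h, (hf _).root_mem⟩⟩
  rw [outdegree, this, Set.ncard_Iio_nat]

lemma weight_graft (ψ : PowerSeries ℝ) (hf : ∀ i, IsPlaneTree (f i : Set (List ℕ))) :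
    weight ψ (graft f) = PowerSeries.coeff d ψ * ∏ i, weight ψ (f i) := by
  rw [weight, prod_graft, outdegree_graft_nil hf]
  simp only [outdegree_graft_cons, weight]

lemma subtree_graft (i : Fin d) : subtree i (graft f) = f i := by
  ext u
  simp

end Graft

lemma graft_subtree {a : Finset (List ℕ)} (ha : IsPlaneTree (a : Set (List ℕ))) {d : ℕ}
    (hd : outdegree (a : Set (List ℕ)) [] = d) : graft (fun i : Fin d => subtree i a) = a := by
  ext u
  rcases u with _ | ⟨j, u⟩
  · simpa using ha.root_mem
  · rw [cons_mem_graft]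
    simp only [mem_subtree, exists_prop, and_iff_right_iff_imp]
    intro h
    rw [← hd, ← ha.append_mem_iff a.finite_toSet]
    exact ha.prefix_mem ([] ++ [j]) u (by simpa using h)

lemma isPlaneTree_subtree {a : Finset (List ℕ)} (ha : IsPlaneTree (a : Set (List ℕ))) {i : ℕ}
    (hi : i < outdegree (a : Set (List ℕ)) []) : IsPlaneTree (subtree i a : Set (List ℕ)) where
  root_mem := by
    have := (ha.append_mem_iff a.finite_toSet [] i).2 hi
    simpa using this
  parent_mem u j h := by
    have := ha.parent_mem (i :: u) j (by simpa using h)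
    simpa using this
  sibling_mem u j l hjl h := by
    have := ha.sibling_mem (i :: u) j l hjl (by simpa using h)
    simpa using this

/-- The recursive description of `∂ ≥ k + 1`: the root is not a leaf, and the subtrees have
`∂ ≥ k`. -/
lemma succ_le_borderDist_iff {a : Finset (List ℕ)} (ha : IsPlaneTree (a : Set (List ℕ))) (k : ℕ) :
    ((k + 1 : ℕ) : ℕ∞) ≤ borderDist (a : Set (List ℕ)) ↔
      outdegree (a : Set (List ℕ)) [] ≠ 0 ∧
        ∀ i : Fin (outdegree (a : Set (List ℕ)) []),
          (k : ℕ∞) ≤ borderDist (subtree i a : Set (List ℕ)) := by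
  have hcons : ∀ i u, i :: u ∈ leaves (a : Set (List ℕ)) ↔
      u ∈ leaves (subtree i a : Set (List ℕ)) := fun i u => by simp [leaves]
  have hnil : [] ∈ leaves (a : Set (List ℕ)) ↔ outdegree (a : Set (List ℕ)) [] = 0 := by
    have h0 := ha.root_mem
    simp only [leaves, Set.mem_ofPred_eq, h0, true_and, ha.append_mem_iff a.finite_toSet]
    exact ⟨fun h => Nat.eq_zero_of_not_pos (h 0), fun h => by simp [h]⟩
  simp only [borderDist, le_iInf_iff]
  constructor
  · intro h
    refine ⟨fun h0 => ?_, fun i u hu => ?_⟩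
    · have := h [] (hnil.2 h0)
      simp at this
    · have := h _ ((hcons i u).2 hu)
      simpa using this
  · rintro ⟨h0, h⟩ (_ | ⟨i, u⟩) hu
    · exact absurd (hnil.1 hu) h0
    · have hi : i < outdegree (a : Set (List ℕ)) [] := by
        rw [← ha.append_mem_iff a.finite_toSet]
        exact ha.prefix_mem ([] ++ [i]) u (by simpa using hu.1)
      have := h ⟨i, hi⟩ u ((hcons i u).1 hu)
      simpa using this

open Classical in
/-- The generating function `∑ zⁿ ∑ w(a)`, the inner sum over the plane trees `a` with `n` nodes
that satisfy `P`. -/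
noncomputable def treeSeries (ψ : PowerSeries ℝ) (P : Finset (List ℕ) → Prop) : PowerSeries ℝ :=
  PowerSeries.mk fun n => ∑ a ∈ (planeTrees n).filter P, weight ψ a

open Classical in
/-- A tree with `n + 1` nodes whose root has `d` children is a `d`-tuple of trees with `n` nodes
in all. -/
lemma sum_weight_outdegree_root (ψ : PowerSeries ℝ) (P : Finset (List ℕ) → Prop) (n d : ℕ) :
    ∑ a ∈ (planeTrees (n + 1)).filter (fun a : Finset (List ℕ) =>
      outdegree (a : Set (List ℕ)) [] = d ∧
      ∀ i : Fin d, P (subtree i a)), weight ψ a =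
    PowerSeries.coeff d ψ * PowerSeries.coeff n (treeSeries ψ P ^ d) := by
  have h1 : treeSeries ψ P ^ d = ∏ _i : Fin d, treeSeries ψ P := by simp
  rw [h1, PowerSeries.coeff_prod]
  simp only [treeSeries, PowerSeries.coeff_mk]
  simp_rw [Finset.prod_univ_sum]
  rw [Finset.mul_sum]
  simp_rw [Finset.mul_sum]
  rw [Finset.sum_sigma']
  refine Finset.sum_bij'
    (fun a _ => ⟨Finsupp.equivFunOnFinite.symm fun i : Fin d => (subtree i a).card,
      fun i => subtree i a⟩)
    (fun x _ => graft x.2) ?_ ?_ ?_ ?_ ?_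
  · intro a ha
    obtain ⟨ha1, had, haP⟩ := Finset.mem_filter.1 ha
    obtain ⟨hT, hc⟩ := mem_planeTrees.1 ha1
    have hg := graft_subtree hT had
    simp only [Finset.mem_sigma, Finset.mem_finsuppAntidiag, Finset.subset_univ, and_true,
      Fintype.mem_piFinset, Finset.mem_filter, mem_planeTrees]
    refine ⟨?_, fun i => ⟨⟨isPlaneTree_subtree hT (by rw [had]; exact i.2), by simp⟩, haP i⟩⟩
    have := card_graft (f := fun i : Fin d => subtree i a)
    rw [hg, hc] at this
    simpa using this.symm
  · rintro ⟨l, f⟩ hx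
    simp only [Finset.mem_sigma, Finset.mem_finsuppAntidiag, Finset.subset_univ, and_true,
      Fintype.mem_piFinset, Finset.mem_filter, mem_planeTrees] at hx
    obtain ⟨hl, hf⟩ := hx
    have hf1 := fun i => (hf i).1.1
    simp only [Finset.mem_filter, mem_planeTrees, subtree_graft]
    refine ⟨⟨isPlaneTree_graft hf1, ?_⟩, outdegree_graft_nil hf1, fun i => (hf i).2⟩
    rw [card_graft, ← hl]
    simp only [(hf _).1.2]
  · intro a ha
    obtain ⟨ha1, had, haP⟩ := Finset.mem_filter.1 ha
    exact graft_subtree (mem_planeTrees.1 ha1).1 had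
  · rintro ⟨l, f⟩ hx
    simp only [Finset.mem_sigma, Finset.mem_finsuppAntidiag, Finset.subset_univ, and_true,
      Fintype.mem_piFinset, Finset.mem_filter, mem_planeTrees] at hx
    simp only [subtree_graft, Sigma.mk.injEq, heq_eq_eq, and_true]
    ext i
    simp [(hx.2 i).1.2]
  · intro a ha
    obtain ⟨ha1, had, haP⟩ := Finset.mem_filter.1 ha
    have hT := (mem_planeTrees.1 ha1).1
    have hg := graft_subtree hT had
    conv_lhs => rw [← hg]
    exact weight_graft ψ fun i => isPlaneTree_subtree hT (by rw [had]; exact i.2)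

lemma outdegree_root_le {n : ℕ} {a : Finset (List ℕ)} (ha : a ∈ planeTrees (n + 1)) :
    outdegree (a : Set (List ℕ)) [] ≤ n := by
  obtain ⟨hT, hc⟩ := mem_planeTrees.1 ha
  have h := card_graft (f := fun i : Fin (outdegree (a : Set (List ℕ)) []) => subtree i a)
  rw [graft_subtree hT rfl, hc, Nat.succ_inj] at h
  rw [h]
  have h1 : ∀ i : Fin (outdegree (a : Set (List ℕ)) []), 1 ≤ (subtree i a).card := fun i =>
    Finset.card_pos.2 ⟨[], (isPlaneTree_subtree hT i.2).root_mem⟩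
  simpa using Finset.sum_le_sum fun i (_ : i ∈ Finset.univ) => h1 i

/-- The generating function of the plane trees with `∂ ≥ k`. -/
noncomputable def borderSeries (ψ : PowerSeries ℝ) (k : ℕ) : PowerSeries ℝ :=
  treeSeries ψ fun a => (k : ℕ∞) ≤ borderDist (a : Set (List ℕ))

lemma coeff_borderSeries (ψ : PowerSeries ℝ) (k n : ℕ) :
    PowerSeries.coeff n (borderSeries ψ k) = ABorder ψ k n := by
  rw [borderSeries, treeSeries, PowerSeries.coeff_mk, ABorder]
  congr!

lemma ABorder_zero_left (ψ : PowerSeries ℝ) (n : ℕ) : ABorder ψ 0 n = A ψ n := by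
  simp [ABorder, A]

lemma planeTrees_zero : planeTrees 0 = ∅ := by
  refine Finset.eq_empty_of_forall_notMem fun a ha => ?_
  obtain ⟨hT, hc⟩ := mem_planeTrees.1 ha
  rw [Finset.card_eq_zero] at hc
  have := hT.root_mem
  simp [hc] at this

lemma ABorder_zero_right (ψ : PowerSeries ℝ) (k : ℕ) : ABorder ψ k 0 = 0 := by
  simp [ABorder, planeTrees_zero]

/-- The functional equation `T = z ψ(T)` of the tree series, coefficient by coefficient. -/
lemma A_succ (ψ : PowerSeries ℝ) (n : ℕ) :
    A ψ (n + 1) = ∑ d ∈ Finset.range (n + 1),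
      PowerSeries.coeff d ψ * PowerSeries.coeff n (borderSeries ψ 0 ^ d) := by
  classical
  rw [A, ← Finset.sum_fiberwise_of_maps_to (t := Finset.range (n + 1))
    (g := fun a : Finset (List ℕ) => outdegree (a : Set (List ℕ)) [])
    (fun a ha => Finset.mem_range_succ_iff.2 (outdegree_root_le ha))]
  refine Finset.sum_congr rfl fun d _ => ?_
  rw [borderSeries, ← sum_weight_outdegree_root]
  simp

/-- The functional equation `T_{k+1} = z (ψ(T_k) - b₀)` of the series of trees with `∂ ≥ k + 1`,
coefficient by coefficient. -/
lemma ABorder_succ (ψ : PowerSeries ℝ) (k n : ℕ) :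
    ABorder ψ (k + 1) (n + 1) = ∑ d ∈ Finset.range (n + 1), if d = 0 then 0 else
      PowerSeries.coeff d ψ * PowerSeries.coeff n (borderSeries ψ k ^ d) := by
  classical
  rw [ABorder, ← Finset.sum_fiberwise_of_maps_to (t := Finset.range (n + 1))
    (g := fun a : Finset (List ℕ) => outdegree (a : Set (List ℕ)) [])
    (fun a ha => Finset.mem_range_succ_iff.2 (outdegree_root_le (Finset.mem_filter.1 ha).1))]
  refine Finset.sum_congr rfl fun d _ => ?_
  rw [Finset.filter_filter]
  split_ifs with hd
  · refine Finset.sum_eq_zero fun a ha => ?_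
    obtain ⟨ha1, hb, h0⟩ := Finset.mem_filter.1 ha
    exact absurd (h0.trans hd) ((succ_le_borderDist_iff (mem_planeTrees.1 ha1).1 k).1 hb).1
  · rw [borderSeries, ← sum_weight_outdegree_root]
    refine Finset.sum_congr (Finset.ext fun a => ?_) fun _ _ => rfl
    simp only [Finset.mem_filter]
    refine and_congr_right fun ha => ?_
    rw [succ_le_borderDist_iff (mem_planeTrees.1 ha).1, and_comm]
    refine and_congr_right fun h => ?_
    subst h
    simp [hd]

/-! ### Lagrange inversion -/

section Lagrange

open PowerSeries

variable {T : PowerSeries ℝ}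

lemma coeff_pow_eq_zero_of_lt (hT0 : coeff 0 T = 0) {n d : ℕ} (h : n < d) :
    coeff n (T ^ d) = 0 := by
  have h1 : (X : PowerSeries ℝ) ∣ T := X_dvd_iff.2 (by simpa using hT0)
  exact X_pow_dvd_iff.1 (pow_dvd_pow_of_dvd h1 d) n h

/-- The equation `T^{j+1} = z T^j ψ(T)`, coefficient by coefficient. -/
lemma coeff_succ_pow_succ (hT0 : coeff 0 T = 0)
    (hT : ∀ n, coeff (n + 1) T = ∑ d ∈ Finset.range (n + 1), coeff d ψ * coeff n (T ^ d))
    (n j : ℕ) : coeff (n + 1) (T ^ (j + 1)) =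
      ∑ d ∈ Finset.range (n + 1), coeff d ψ * coeff n (T ^ (j + d)) := by
  rw [pow_succ, coeff_mul, Finset.Nat.sum_antidiagonal_succ']
  simp only [hT0, mul_zero, zero_add]
  have h : ∀ p ∈ Finset.HasAntidiagonal.antidiagonal n, coeff p.1 (T ^ j) * coeff (p.2 + 1) T =
      ∑ d ∈ Finset.range (n + 1), coeff d ψ * (coeff p.1 (T ^ j) * coeff p.2 (T ^ d)) := by
    intro p hp
    have hp2 : p.2 ≤ n := (by have := Finset.HasAntidiagonal.mem_antidiagonal.1 hp; omega)
    rw [hT, Finset.mul_sum]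
    refine Finset.sum_subset_zero_on_sdiff (Finset.range_mono (by omega)) (fun d hd => ?_)
      fun d _ => by ring
    rw [Finset.mem_sdiff, Finset.mem_range, Finset.mem_range] at hd
    rw [coeff_pow_eq_zero_of_lt hT0 (show p.2 < d by omega)]
    ring
  rw [Finset.sum_congr rfl h, Finset.sum_comm]
  refine Finset.sum_congr rfl fun d _ => ?_
  rw [← Finset.mul_sum, pow_add, coeff_mul]

lemma coeff_X_mul_derivative (f : PowerSeries ℝ) (n : ℕ) :
    coeff n (X * PowerSeries.derivative ℝ f) = n * coeff n f := by
  rcases n with _ | n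
  · simp
  · rw [coeff_succ_X_mul, PowerSeries.coeff_derivative]
    push_cast
    ring

/-- The coefficients of `z ψ' ψⁿ = z (ψ^{n+1})' / (n + 1)`. -/
lemma sum_antidiagonal_mul_coeff_pow (ψ : PowerSeries ℝ) (n m : ℕ) :
    ((n : ℝ) + 1) * ∑ p ∈ Finset.HasAntidiagonal.antidiagonal m,
      (p.1 : ℝ) * coeff p.1 ψ * coeff p.2 (ψ ^ n) =
      m * coeff m (ψ ^ (n + 1)) := by
  rw [← coeff_X_mul_derivative]
  have h : X * PowerSeries.derivative ℝ (ψ ^ (n + 1)) =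
      ((n + 1 : ℕ) : PowerSeries ℝ) * ((X * PowerSeries.derivative ℝ ψ) * ψ ^ n) := by
    rw [Derivation.leibniz_pow, Nat.add_sub_cancel]
    simp only [nsmul_eq_mul, smul_eq_mul]
    ring
  rw [h, ← nsmul_eq_mul, map_nsmul, nsmul_eq_mul, coeff_mul]
  simp only [coeff_X_mul_derivative]
  push_cast
  ring

/-- Lagrange's formula `[zⁿ] Tʲ = (j / n) [w^{n-j}] ψⁿ` for the solution of `T = z ψ(T)`, proved by
induction on `n` from `T^{j+1} = z T^j ψ(T)`. The coefficient is `0` for `j > n`, where the natural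
number `n - j` is truncated. -/
lemma lagrange_pow (hT0 : coeff 0 T = 0)
    (hT : ∀ n, coeff (n + 1) T = ∑ d ∈ Finset.range (n + 1), coeff d ψ * coeff n (T ^ d))
    (n j : ℕ) : ((n : ℝ) + 1) * coeff (n + 1) (T ^ j) =
      j * (if j ≤ n + 1 then coeff (n + 1 - j) (ψ ^ (n + 1)) else 0) := by
  induction n generalizing j with
  | zero =>
    rcases j with _ | j
    · simp
    · rw [coeff_succ_pow_succ hT0 hT]
      rcases j with _ | j
      · simp
      · have h0 := coeff_pow_eq_zero_of_lt hT0 (Nat.succ_pos j)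
        rw [Finset.sum_range_one, add_zero, h0, if_neg (by omega)]
        simp
  | succ n ih =>
    rcases j with _ | j
    · simp [coeff_one]
    · rw [coeff_succ_pow_succ hT0 hT]
      have hn : ((n : ℝ) + 1) ≠ 0 := by positivity
      refine mul_left_cancel₀ hn ?_
      have h1 : ((n : ℝ) + 1) * ∑ d ∈ Finset.range (n + 1 + 1),
          coeff d ψ * coeff (n + 1) (T ^ (j + d)) =
          ∑ d ∈ Finset.range (n + 1 + 1), coeff d ψ * ((j + d : ℕ) *
            (if j + d ≤ n + 1 then coeff (n + 1 - (j + d)) (ψ ^ (n + 1)) else 0)) := by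
        rw [Finset.mul_sum]
        refine Finset.sum_congr rfl fun d _ => ?_
        rw [← ih]
        ring
      by_cases hj : j ≤ n + 1
      -- The sum splits into `j [wᵐ] ψ^{n+2}` and `[wᵐ] w ψ' ψ^{n+1}`, where `m = n + 1 - j`.
      · obtain ⟨m, hm⟩ := Nat.exists_eq_add_of_le hj
        have h2 : ∑ d ∈ Finset.range (n + 1 + 1), coeff d ψ * ((j + d : ℕ) *
            (if j + d ≤ n + 1 then coeff (n + 1 - (j + d)) (ψ ^ (n + 1)) else 0)) =
            ∑ p ∈ Finset.HasAntidiagonal.antidiagonal m, coeff p.1 ψ * ((j + p.1 : ℕ) *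
              coeff p.2 (ψ ^ (n + 1))) := by
          rw [Finset.Nat.sum_antidiagonal_eq_sum_range_succ
            (fun a b => coeff a ψ * ((j + a : ℕ) * coeff b (ψ ^ (n + 1))))]
          symm
          refine Finset.sum_subset_zero_on_sdiff (Finset.range_mono (by omega)) (fun d hd => ?_)
            fun d hd => ?_
          · rw [Finset.mem_sdiff, Finset.mem_range, Finset.mem_range] at hd
            rw [if_neg (by omega)]
            ring
          · rw [Finset.mem_range] at hd
            rw [if_pos (by omega), show n + 1 - (j + d) = m - d by omega]
        have h3 : ∑ p ∈ Finset.HasAntidiagonal.antidiagonal m, coeff p.1 ψ * ((j + p.1 : ℕ) *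
              coeff p.2 (ψ ^ (n + 1))) = j * coeff m (ψ ^ (n + 1 + 1)) +
            ∑ p ∈ Finset.HasAntidiagonal.antidiagonal m,
              (p.1 : ℝ) * coeff p.1 ψ * coeff p.2 (ψ ^ (n + 1)) := by
          rw [pow_succ' ψ (n + 1), coeff_mul, Finset.mul_sum, ← Finset.sum_add_distrib]
          refine Finset.sum_congr rfl fun p _ => ?_
          push_cast
          ring
        have h4 := sum_antidiagonal_mul_coeff_pow ψ (n + 1) m
        rw [if_pos (by omega), show n + 1 + 1 - (j + 1) = m by omega]
        have h5 : (n : ℝ) + 1 = j + m := by exact_mod_cast hm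
        set S := ∑ p ∈ Finset.HasAntidiagonal.antidiagonal m,
          (p.1 : ℝ) * coeff p.1 ψ * coeff p.2 (ψ ^ (n + 1))
        rw [mul_left_comm, h1, h2, h3]
        push_cast at h4 ⊢
        rw [mul_add, h4]
        have h6 : (m : ℝ) = n + 1 - j := by linarith
        rw [h6]
        ring
      · rw [mul_left_comm, h1, if_neg (by omega), Finset.sum_eq_zero]
        · simp
        · intro d _
          rw [if_neg (by omega)]
          ring

end Lagrange

/-- `Aₙ = (1/n) [w^{n-1}] ψⁿ`. -/
lemma succ_mul_A_succ (ψ : PowerSeries ℝ) (n : ℕ) :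
    ((n : ℝ) + 1) * A ψ (n + 1) = PowerSeries.coeff n (ψ ^ (n + 1)) := by
  have h0 : PowerSeries.coeff 0 (borderSeries ψ 0) = 0 := by
    rw [coeff_borderSeries, ABorder_zero_right]
  have hT : ∀ n, PowerSeries.coeff (n + 1) (borderSeries ψ 0) = ∑ d ∈ Finset.range (n + 1),
      PowerSeries.coeff d ψ * PowerSeries.coeff n (borderSeries ψ 0 ^ d) := fun n => by
    rw [coeff_borderSeries, ABorder_zero_left, A_succ]
  have h := lagrange_pow h0 hT n 1
  rw [pow_one, coeff_borderSeries, ABorder_zero_left] at h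
  simpa using h

/-! ### Powers of absolutely convergent power series -/

section Powers

variable {𝕜 : Type*} [RCLike 𝕜] {f g : PowerSeries ℝ} {z : 𝕜}

lemma coeff_mul_mul_pow (f g : PowerSeries ℝ) (z : 𝕜) (n : ℕ) :
    ((PowerSeries.coeff n (f * g) : ℝ) : 𝕜) * z ^ n =
      ∑ p ∈ Finset.HasAntidiagonal.antidiagonal n,
        (((PowerSeries.coeff p.1 f : ℝ) : 𝕜) * z ^ p.1) *
          (((PowerSeries.coeff p.2 g : ℝ) : 𝕜) * z ^ p.2) := by
  rw [PowerSeries.coeff_mul, RCLike.ofReal_sum, Finset.sum_mul]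
  refine Finset.sum_congr rfl fun p hp => ?_
  have h : p.1 + p.2 = n := Finset.HasAntidiagonal.mem_antidiagonal.1 hp
  subst h
  rw [pow_add, RCLike.ofReal_mul, mul_mul_mul_comm]

lemma summable_norm_coeff_mul
    (hf : Summable fun n => ‖((PowerSeries.coeff n f : ℝ) : 𝕜) * z ^ n‖)
    (hg : Summable fun n => ‖((PowerSeries.coeff n g : ℝ) : 𝕜) * z ^ n‖) :
    Summable fun n => ‖((PowerSeries.coeff n (f * g) : ℝ) : 𝕜) * z ^ n‖ := by
  simp_rw [coeff_mul_mul_pow]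
  exact summable_norm_sum_mul_antidiagonal_of_summable_norm
    (f := fun n => ((PowerSeries.coeff n f : ℝ) : 𝕜) * z ^ n)
    (g := fun n => ((PowerSeries.coeff n g : ℝ) : 𝕜) * z ^ n) hf hg

lemma value_mul
    (hf : Summable fun n => ‖((PowerSeries.coeff n f : ℝ) : 𝕜) * z ^ n‖)
    (hg : Summable fun n => ‖((PowerSeries.coeff n g : ℝ) : 𝕜) * z ^ n‖) :
    value (f * g) z = value f z * value g z := by
  rw [value, value, value, tsum_mul_tsum_eq_tsum_sum_antidiagonal_of_summable_norm hf hg]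
  simp_rw [coeff_mul_mul_pow]

lemma value_one (z : 𝕜) : value (1 : PowerSeries ℝ) z = 1 := by
  rw [value, tsum_eq_single 0]
  · simp
  · intro n hn
    simp [PowerSeries.coeff_one, hn]

lemma summable_norm_coeff_one (z : 𝕜) :
    Summable fun n => ‖((PowerSeries.coeff n (1 : PowerSeries ℝ) : ℝ) : 𝕜) * z ^ n‖ := by
  refine summable_of_ne_finset_zero (s := {0}) fun n hn => ?_
  have : n ≠ 0 := by simpa using hn
  simp [PowerSeries.coeff_one, this]

lemma summable_norm_coeff_pow
    (hf : Summable fun n => ‖((PowerSeries.coeff n f : ℝ) : 𝕜) * z ^ n‖) (d : ℕ) :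
    Summable fun n => ‖((PowerSeries.coeff n (f ^ d) : ℝ) : 𝕜) * z ^ n‖ := by
  induction d with
  | zero => simpa only [pow_zero f] using summable_norm_coeff_one z
  | succ d ih =>
    rw [pow_succ f]
    exact summable_norm_coeff_mul ih hf

lemma value_pow
    (hf : Summable fun n => ‖((PowerSeries.coeff n f : ℝ) : 𝕜) * z ^ n‖) (d : ℕ) :
    value (f ^ d) z = value f z ^ d := by
  induction d with
  | zero => simpa using value_one z
  | succ d ih =>
    rw [pow_succ f, pow_succ, value_mul (summable_norm_coeff_pow hf d) hf, ih]

lemma coeff_mul_nonneg (hf : ∀ n, 0 ≤ PowerSeries.coeff n f)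
    (hg : ∀ n, 0 ≤ PowerSeries.coeff n g) (n : ℕ) : 0 ≤ PowerSeries.coeff n (f * g) := by
  rw [PowerSeries.coeff_mul]
  exact Finset.sum_nonneg fun p _ => mul_nonneg (hf _) (hg _)

lemma coeff_pow_nonneg (hf : ∀ n, 0 ≤ PowerSeries.coeff n f) (d n : ℕ) :
    0 ≤ PowerSeries.coeff n (f ^ d) := by
  induction d generalizing n with
  | zero =>
    rw [pow_zero, PowerSeries.coeff_one]
    split_ifs <;> norm_num
  | succ d ih =>
    rw [pow_succ]
    exact coeff_mul_nonneg ih hf n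

lemma coeff_mul_modEq {Q r s : ℕ} (hf : ∀ n, PowerSeries.coeff n f ≠ 0 → n ≡ r [MOD Q])
    (hg : ∀ n, PowerSeries.coeff n g ≠ 0 → n ≡ s [MOD Q]) (n : ℕ)
    (h : PowerSeries.coeff n (f * g) ≠ 0) : n ≡ r + s [MOD Q] := by
  rw [PowerSeries.coeff_mul] at h
  obtain ⟨p, hp, hne⟩ := Finset.exists_ne_zero_of_sum_ne_zero h
  rw [← Finset.HasAntidiagonal.mem_antidiagonal.1 hp]
  exact (hf _ (left_ne_zero_of_mul hne)).add (hg _ (right_ne_zero_of_mul hne))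

lemma coeff_pow_modEq {Q r : ℕ} (hf : ∀ n, PowerSeries.coeff n f ≠ 0 → n ≡ r [MOD Q]) (d n : ℕ)
    (h : PowerSeries.coeff n (f ^ d) ≠ 0) : n ≡ d * r [MOD Q] := by
  induction d generalizing n with
  | zero =>
    rw [pow_zero, PowerSeries.coeff_one] at h
    have : n = 0 := by
      by_contra hn
      simp [hn] at h
    simp [this, Nat.ModEq.refl]
  | succ d ih =>
    rw [pow_succ] at h
    rw [Nat.succ_mul]
    exact coeff_mul_modEq ih hf n h

end Powers

/-! ### A local limit theorem -/

/-- `P` is the generating function of a law on `ℕ` with mean `1`, an atom at `0` and a third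
moment, whose support generates the group `Qℤ`. -/
structure IsCriticalLaw (P : PowerSeries ℝ) (Q : ℕ) : Prop where
  nonneg : ∀ n, 0 ≤ PowerSeries.coeff n P
  zero_pos : 0 < PowerSeries.coeff 0 P
  summable : Summable fun n => PowerSeries.coeff n P
  tsum_eq : ∑' n, PowerSeries.coeff n P = 1
  mean_eq : ∑' n : ℕ, ((n : ℝ) - 1) * PowerSeries.coeff n P = 0
  third : Summable fun n : ℕ => (n : ℝ) ^ 3 * PowerSeries.coeff n P
  period_pos : 0 < Q
  dvd : ∀ n, 0 < PowerSeries.coeff n P → Q ∣ n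
  dvd_of : ∀ d, (∀ n, 0 < PowerSeries.coeff n P → d ∣ n) → d ∣ Q

/-- The characteristic function of the law with generating function `P`. -/
noncomputable def charFn (P : PowerSeries ℝ) (θ : ℝ) : ℂ :=
  value P (Complex.exp (θ * Complex.I))

section LocalLimit

variable {P : PowerSeries ℝ} {Q : ℕ}

lemma norm_cis (θ : ℝ) : ‖Complex.exp (θ * Complex.I)‖ = 1 :=
  Complex.norm_exp_ofReal_mul_I θ

lemma norm_ofReal_mul_cis {c : ℝ} (hc : 0 ≤ c) (θ : ℝ) (n : ℕ) :
    ‖((c : ℝ) : ℂ) * Complex.exp (θ * Complex.I) ^ n‖ = c := by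
  rw [norm_mul, norm_pow, norm_cis, one_pow, mul_one, Complex.norm_real, Real.norm_of_nonneg hc]

lemma summable_norm_cis (hP : IsCriticalLaw P Q) (θ : ℝ) :
    Summable fun n => ‖((PowerSeries.coeff n P : ℝ) : ℂ) * Complex.exp (θ * Complex.I) ^ n‖ := by
  simp_rw [norm_ofReal_mul_cis (hP.nonneg _)]
  exact hP.summable

lemma summable_coeff_pow (hP : IsCriticalLaw P Q) (d : ℕ) :
    Summable fun n => PowerSeries.coeff n (P ^ d) := by
  have := summable_norm_coeff_pow (summable_norm_cis hP 0) d
  exact this.congr fun n => norm_ofReal_mul_cis (coeff_pow_nonneg hP.nonneg d n) 0 n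

lemma norm_charFn_le (hP : IsCriticalLaw P Q) (θ : ℝ) : ‖charFn P θ‖ ≤ 1 := by
  rw [charFn, value]
  refine (norm_tsum_le_tsum_norm (summable_norm_cis hP θ)).trans ?_
  simp_rw [norm_ofReal_mul_cis (hP.nonneg _), hP.tsum_eq]
  exact le_rfl

lemma continuous_charFn (hP : IsCriticalLaw P Q) : Continuous (charFn P) := by
  refine continuous_tsum (u := fun n => PowerSeries.coeff n P) (fun n => by fun_prop) hP.summable
    fun n θ => ?_
  exact (norm_ofReal_mul_cis (hP.nonneg n) θ n).le

lemma sq_norm_sub_of_norm_eq_one {z u : ℂ} (hz : ‖z‖ = 1) (hu : ‖u‖ = 1) :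
    ‖z - u‖ ^ 2 = 2 - 2 * (z * (starRingEnd ℂ) u).re := by
  rw [← Complex.normSq_eq_norm_sq, Complex.normSq_sub, Complex.normSq_eq_norm_sq,
    Complex.normSq_eq_norm_sq, hz, hu]
  norm_num

/-- If `u` is the direction of `φ(θ)`, then every atom of the law pulls `e^{inθ}` towards `u`. -/
lemma exists_coeff_mul_sq_norm_sub_le (hP : IsCriticalLaw P Q) (θ : ℝ) :
    ∃ u : ℂ, ∀ n, PowerSeries.coeff n P * ‖Complex.exp (θ * Complex.I) ^ n - u‖ ^ 2 ≤
      2 * (1 - ‖charFn P θ‖) := by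
  set u : ℂ := Complex.exp ((charFn P θ).arg * Complex.I) with hu
  have hu1 : ‖u‖ = 1 := norm_cis _
  have huu : u * (starRingEnd ℂ) u = 1 := by
    rw [Complex.mul_conj, Complex.normSq_eq_norm_sq, hu1]
    norm_num
  have hφ : charFn P θ * (starRingEnd ℂ) u = (‖charFn P θ‖ : ℂ) := by
    conv_lhs => rw [← Complex.norm_mul_exp_arg_mul_I (charFn P θ)]
    rw [mul_assoc, ← hu, huu, mul_one]
  have hS := (summable_norm_cis hP θ).of_norm
  have hre : HasSum (fun n => PowerSeries.coeff n P *
      (Complex.exp (θ * Complex.I) ^ n * (starRingEnd ℂ) u).re) ‖charFn P θ‖ := by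
    have h1 : HasSum (fun n => ((PowerSeries.coeff n P : ℝ) : ℂ) * Complex.exp (θ * Complex.I) ^ n *
        (starRingEnd ℂ) u) (‖charFn P θ‖ : ℂ) := by
      rw [← hφ]
      exact hS.hasSum.mul_right _
    have h2 := Complex.hasSum_re h1
    simpa only [mul_assoc, Complex.re_ofReal_mul, Complex.ofReal_re] using h2
  have hone : HasSum (fun n => PowerSeries.coeff n P) 1 := hP.tsum_eq ▸ hP.summable.hasSum
  have hsq : HasSum (fun n => PowerSeries.coeff n P *
      ‖Complex.exp (θ * Complex.I) ^ n - u‖ ^ 2) (2 * (1 - ‖charFn P θ‖)) := by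
    refine ((hone.sub hre).mul_left 2).congr_fun fun n => ?_
    rw [sq_norm_sub_of_norm_eq_one (by rw [norm_pow, norm_cis, one_pow]) hu1]
    ring
  refine ⟨u, fun n => ?_⟩
  exact le_hasSum hsq n fun m _ => mul_nonneg (hP.nonneg m) (by positivity)

/-- `e^{iQθ}` is close to `1` whenever `|φ(θ)|` is: the integers `l` for which `e^{ilθ}` has this
property form a subgroup of `ℤ` that contains the support of the law, hence `Q`. -/
lemma exists_sq_norm_cis_sub_one_le (hP : IsCriticalLaw P Q) :
    ∃ C : ℝ, 0 < C ∧ ∀ θ : ℝ, ‖Complex.exp (θ * Complex.I) ^ Q - 1‖ ^ 2 ≤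
      C * (1 - ‖charFn P θ‖) := by
  let H : AddSubgroup ℤ :=
    { carrier := {l | ∃ C : ℝ, ∀ θ : ℝ, ‖Complex.exp (θ * Complex.I) ^ l - 1‖ ^ 2 ≤
        C * (1 - ‖charFn P θ‖)}
      zero_mem' := ⟨0, fun θ => by simp⟩
      add_mem' := by
        rintro a b ⟨C, hC⟩ ⟨D, hD⟩
        refine ⟨2 * (C + D), fun θ => ?_⟩
        set z := Complex.exp (θ * Complex.I) with hz
        have hz1 : ‖z ^ a‖ = 1 := by rw [norm_zpow, norm_cis, one_zpow]
        have h1 : ‖z ^ (a + b) - 1‖ ≤ ‖z ^ b - 1‖ + ‖z ^ a - 1‖ := by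
          rw [zpow_add₀ (Complex.exp_ne_zero _)]
          calc ‖z ^ a * z ^ b - 1‖ = ‖z ^ a * (z ^ b - 1) + (z ^ a - 1)‖ := by ring_nf
            _ ≤ ‖z ^ a * (z ^ b - 1)‖ + ‖z ^ a - 1‖ := norm_add_le _ _
            _ = _ := by rw [norm_mul, hz1, one_mul]
        have h2 := hC θ
        have h3 := hD θ
        have h4 := pow_le_pow_left₀ (norm_nonneg _) h1 2
        nlinarith [sq_nonneg (‖z ^ b - 1‖ - ‖z ^ a - 1‖)]
      neg_mem' := by
        rintro a ⟨C, hC⟩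
        refine ⟨C, fun θ => ?_⟩
        have hz1 : ‖Complex.exp (θ * Complex.I) ^ (-a)‖ = 1 := by rw [norm_zpow, norm_cis, one_zpow]
        have h1 : Complex.exp (θ * Complex.I) ^ (-a) - 1 =
            - (Complex.exp (θ * Complex.I) ^ (-a) * (Complex.exp (θ * Complex.I) ^ a - 1)) := by
          rw [mul_sub, ← zpow_add₀ (Complex.exp_ne_zero _)]
          simp
        rw [h1, norm_neg, norm_mul, hz1, one_mul]
        exact hC θ }
  have hsupp : ∀ n : ℕ, 0 < PowerSeries.coeff n P → (n : ℤ) ∈ H := by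
    intro n hn
    refine ⟨2 * (2 / PowerSeries.coeff n P + 2 / PowerSeries.coeff 0 P), fun θ => ?_⟩
    obtain ⟨u, hu⟩ := exists_coeff_mul_sq_norm_sub_le hP θ
    have h1 := hu n
    have h2 := hu 0
    rw [mul_comm, ← le_div_iff₀ hn] at h1
    rw [mul_comm, ← le_div_iff₀ hP.zero_pos, pow_zero] at h2
    rw [zpow_natCast]
    have h3 : ‖Complex.exp (θ * Complex.I) ^ n - 1‖ ≤
        ‖Complex.exp (θ * Complex.I) ^ n - u‖ + ‖1 - u‖ := by
      calc _ = ‖(Complex.exp (θ * Complex.I) ^ n - u) - (1 - u)‖ := by ring_nf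
        _ ≤ _ := norm_sub_le _ _
    have h4 := pow_le_pow_left₀ (norm_nonneg _) h3 2
    have h5 := sq_nonneg (‖Complex.exp (θ * Complex.I) ^ n - u‖ - ‖1 - u‖)
    calc _ ≤ 2 * (‖Complex.exp (θ * Complex.I) ^ n - u‖ ^ 2 + ‖1 - u‖ ^ 2) := by nlinarith
      _ ≤ 2 * (2 * (1 - ‖charFn P θ‖) / PowerSeries.coeff n P +
          2 * (1 - ‖charFn P θ‖) / PowerSeries.coeff 0 P) := by gcongr
      _ = _ := by ring
  obtain ⟨a, ha⟩ := Int.subgroup_cyclic H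
  have hQ : (Q : ℤ) ∈ H := by
    rw [← AddSubgroup.zmultiples_eq_closure] at ha
    rw [ha, Int.mem_zmultiples_iff, ← Int.natAbs_dvd, Int.natCast_dvd_natCast]
    refine hP.dvd_of _ fun n hn => ?_
    have := hsupp n hn
    rwa [ha, Int.mem_zmultiples_iff, ← Int.natAbs_dvd, Int.natCast_dvd_natCast] at this
  obtain ⟨C, hC⟩ := hQ
  refine ⟨|C| + 1, by positivity, fun θ => ?_⟩
  have h1 := hC θ
  have h2 : 0 ≤ 1 - ‖charFn P θ‖ := sub_nonneg.2 (norm_charFn_le hP θ)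
  rw [zpow_natCast] at h1
  exact h1.trans (mul_le_mul_of_nonneg_right (by linarith [le_abs_self C]) h2)

/-- On a fundamental domain of its periods, the characteristic function has Gaussian decay. -/
lemma exists_norm_charFn_le_exp (hP : IsCriticalLaw P Q) :
    ∃ c : ℝ, 0 < c ∧ ∀ θ : ℝ, |θ| ≤ Real.pi / Q → ‖charFn P θ‖ ≤ Real.exp (-c * θ ^ 2) := by
  obtain ⟨C, hC0, hC⟩ := exists_sq_norm_cis_sub_one_le hP
  have hQ : (0 : ℝ) < Q := by exact_mod_cast hP.period_pos
  refine ⟨4 * Q ^ 2 / (Real.pi ^ 2 * C), by positivity, fun θ hθ => ?_⟩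
  have h1 := hC θ
  have h2 : |(Q : ℝ) * θ| ≤ Real.pi := by
    rw [abs_mul, abs_of_pos hQ]
    rwa [le_div_iff₀' hQ] at hθ
  have h3 := Real.cos_le_one_sub_mul_cos_sq h2
  rw [sq_norm_sub_of_norm_eq_one (by rw [norm_pow, norm_cis, one_pow]) (by simp), map_one, mul_one,
    ← Complex.exp_nat_mul, show (Q : ℂ) * (θ * Complex.I) = ((Q * θ : ℝ) : ℂ) * Complex.I by
      push_cast; ring, Complex.exp_ofReal_mul_I_re] at h1
  have h4 : 4 * Q ^ 2 / (Real.pi ^ 2 * C) * θ ^ 2 ≤ 1 - ‖charFn P θ‖ := by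
    have h5 : 4 / Real.pi ^ 2 * (Q * θ) ^ 2 ≤ C * (1 - ‖charFn P θ‖) := by
      refine le_trans ?_ h1
      have : 4 / Real.pi ^ 2 * (Q * θ) ^ 2 = 2 * (2 / Real.pi ^ 2 * (Q * θ) ^ 2) := by ring
      linarith
    rw [← div_le_iff₀' hC0] at h5
    refine le_trans (le_of_eq ?_) h5
    field_simp
  have h6 := Real.add_one_le_exp (-(4 * Q ^ 2 / (Real.pi ^ 2 * C)) * θ ^ 2)
  linarith

lemma charFn_pow (hP : IsCriticalLaw P Q) (n : ℕ) (θ : ℝ) :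
    charFn P θ ^ n = ∑' l : ℕ, ((PowerSeries.coeff l (P ^ n) : ℝ) : ℂ) *
      Complex.exp (θ * Complex.I) ^ l :=
  (value_pow (summable_norm_cis hP θ) n).symm

/-- Orthogonality of the characters of `Qℤ` on `[-π/Q, π/Q]`. -/
lemma integral_cis_pow_mul (hQ : 0 < Q) {l m : ℕ} (hl : Q ∣ l) (hm : Q ∣ m) :
    ∫ θ in (-(Real.pi / Q))..(Real.pi / Q), Complex.exp (θ * Complex.I) ^ l *
      Complex.exp (-(m * θ * Complex.I)) =
      if l = m then ((2 * Real.pi / Q : ℝ) : ℂ) else 0 := by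
  have hQ' : (Q : ℂ) ≠ 0 := by exact_mod_cast hQ.ne'
  split_ifs with h
  · subst h
    have : ∀ θ : ℝ, Complex.exp (θ * Complex.I) ^ l * Complex.exp (-(l * θ * Complex.I)) = 1 := by
      intro θ
      rw [← Complex.exp_nat_mul, ← Complex.exp_add]
      ring_nf
      exact Complex.exp_zero
    simp_rw [this]
    rw [intervalIntegral.integral_const, Complex.real_smul, mul_one]
    congr 1
    ring
  · obtain ⟨a, rfl⟩ := hl
    obtain ⟨b, rfl⟩ := hm
    have hab : ((a : ℂ) - b) ≠ 0 := by
      rw [sub_ne_zero]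
      exact fun hab => h (by rw [Nat.cast_injective hab])
    have hc : (Q : ℂ) * (a - b) * Complex.I ≠ 0 :=
      mul_ne_zero (mul_ne_zero hQ' hab) Complex.I_ne_zero
    have h1 : ∀ θ : ℝ, Complex.exp (θ * Complex.I) ^ (Q * a) *
        Complex.exp (-(((Q * b : ℕ) : ℂ) * θ * Complex.I)) =
        Complex.exp ((Q : ℂ) * (a - b) * Complex.I * θ) := by
      intro θ
      rw [← Complex.exp_nat_mul, ← Complex.exp_add]
      congr 1
      push_cast
      ring
    simp_rw [h1]
    rw [integral_exp_mul_complex hc, div_eq_zero_iff]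
    left
    rw [sub_eq_zero, Complex.exp_eq_exp_iff_exists_int]
    refine ⟨(a : ℤ) - b, ?_⟩
    push_cast
    field_simp
    ring

lemma coeff_pow_eq_zero_of_not_dvd (hP : IsCriticalLaw P Q) {n l : ℕ} (hl : ¬ Q ∣ l) :
    PowerSeries.coeff l (P ^ n) = 0 := by
  by_contra h
  have h1 : ∀ j, PowerSeries.coeff j P ≠ 0 → j ≡ 0 [MOD Q] := fun j hj =>
    (Nat.modEq_zero_iff_dvd).2 (hP.dvd j (lt_of_le_of_ne (hP.nonneg j) (Ne.symm hj)))
  have h2 := coeff_pow_modEq h1 n l h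
  rw [mul_zero] at h2
  exact hl (Nat.modEq_zero_iff_dvd.1 h2)

/-- Fourier inversion for the `n`-fold convolution power of the law. -/
lemma integral_charFn_pow (hP : IsCriticalLaw P Q) (n : ℕ) {m : ℕ} (hm : Q ∣ m) :
    ∫ θ in (-(Real.pi / Q))..(Real.pi / Q), charFn P θ ^ n * Complex.exp (-(m * θ * Complex.I)) =
      ((2 * Real.pi / Q * PowerSeries.coeff m (P ^ n) : ℝ) : ℂ) := by
  set F : ℕ → ℝ → ℂ := fun l θ => ((PowerSeries.coeff l (P ^ n) : ℝ) : ℂ) *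
    (Complex.exp (θ * Complex.I) ^ l * Complex.exp (-(m * θ * Complex.I))) with hF
  have hFn : ∀ l θ, ‖F l θ‖ = PowerSeries.coeff l (P ^ n) := by
    intro l θ
    have : ‖Complex.exp (-(m * θ * Complex.I))‖ = 1 := by
      rw [show -(m * θ * Complex.I) = ((-(m * θ) : ℝ) : ℂ) * Complex.I by push_cast; ring]
      exact norm_cis _
    rw [hF]
    dsimp only
    rw [← mul_assoc, norm_mul, this, mul_one,
      norm_ofReal_mul_cis (coeff_pow_nonneg hP.nonneg n l)]
  have hsum : ∀ θ : ℝ, HasSum (fun l => F l θ)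
      (charFn P θ ^ n * Complex.exp (-(m * θ * Complex.I))) := by
    intro θ
    have h1 := (summable_norm_coeff_pow (summable_norm_cis hP θ) n).of_norm.hasSum.mul_right
      (Complex.exp (-(m * θ * Complex.I)))
    have h2 := charFn_pow hP n θ
    simp only [RCLike.ofReal_eq_complex_ofReal] at h1
    rw [← h2] at h1
    simpa only [hF, mul_assoc] using h1
  have key : HasSum (fun l => ∫ θ in (-(Real.pi / Q))..(Real.pi / Q), F l θ)
      (∫ θ in (-(Real.pi / Q))..(Real.pi / Q),
        charFn P θ ^ n * Complex.exp (-(m * θ * Complex.I))) := by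
    refine intervalIntegral.hasSum_integral_of_dominated_convergence
      (fun l _ => PowerSeries.coeff l (P ^ n)) (fun l => ?_) (fun l => ?_) ?_ ?_ ?_
    · exact Continuous.aestronglyMeasurable (by fun_prop)
    · exact ae_of_all _ fun θ _ => (hFn l θ).le
    · exact ae_of_all _ fun θ _ => summable_coeff_pow hP n
    · exact intervalIntegrable_const
    · exact ae_of_all _ fun θ _ => hsum θ
  rw [← key.tsum_eq, tsum_eq_single m]
  · rw [hF]
    dsimp only
    rw [intervalIntegral.integral_const_mul, integral_cis_pow_mul hP.period_pos hm hm, if_pos rfl]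
    push_cast
    ring
  · intro l hl
    rw [hF]
    dsimp only
    rw [intervalIntegral.integral_const_mul]
    by_cases hd : Q ∣ l
    · rw [integral_cis_pow_mul hP.period_pos hd hm, if_neg hl, mul_zero]
    · rw [coeff_pow_eq_zero_of_not_dvd hP hd]
      simp

/-- The variance of the law (its mean is `1`). -/
noncomputable def centredSecondMoment (P : PowerSeries ℝ) : ℝ :=
  ∑' n : ℕ, ((n : ℝ) - 1) ^ 2 * PowerSeries.coeff n P

lemma norm_cis_sub_taylor_le (y : ℝ) :
    ‖Complex.exp (y * Complex.I) - (1 + y * Complex.I - (y : ℂ) ^ 2 / 2)‖ ≤ 4 * |y| ^ 3 := by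
  have hI : ((y : ℂ) * Complex.I) ^ 2 = -(y : ℂ) ^ 2 := by
    rw [mul_pow, Complex.I_sq]
    ring
  have hny : ‖(y : ℂ) * Complex.I‖ = |y| := by simp
  rcases le_total |y| 1 with h | h
  · have h1 := Complex.norm_exp_sub_sum_le_norm_mul_exp (y * Complex.I) 3
    simp only [Finset.sum_range_succ, Finset.sum_range_zero, zero_add, pow_zero, pow_one, hI, hny,
      Nat.factorial, Nat.cast_one, div_one] at h1
    norm_num at h1
    have h2 : Real.exp |y| ≤ 4 :=
      (Real.exp_le_exp.2 h).trans (by linarith [Real.exp_one_lt_d9])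
    calc _ = ‖Complex.exp (y * Complex.I) - (1 + y * Complex.I + -(y : ℂ) ^ 2 / 2)‖ := by
          congr 1; ring
      _ ≤ |y| ^ 3 * Real.exp |y| := h1
      _ ≤ |y| ^ 3 * 4 := by gcongr
      _ = _ := mul_comm _ _
  · have h0 := abs_nonneg y
    have h1 : |y| ≤ |y| ^ 3 := le_self_pow₀ h (by norm_num)
    have h2 : |y| ^ 2 ≤ |y| ^ 3 := pow_le_pow_right₀ h (by norm_num)
    have e2 : ‖(y : ℂ) ^ 2 / 2‖ = |y| ^ 2 / 2 := by
      rw [norm_div, norm_pow, Complex.norm_real, Real.norm_eq_abs]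
      norm_num
    calc _ ≤ ‖Complex.exp (y * Complex.I)‖ + ‖1 + (y : ℂ) * Complex.I - (y : ℂ) ^ 2 / 2‖ :=
          norm_sub_le _ _
      _ ≤ 1 + (1 + |y| + |y| ^ 2 / 2) := by
          gcongr
          · exact (norm_cis y).le
          · refine (norm_sub_le _ _).trans ?_
            rw [e2]
            gcongr
            refine (norm_add_le _ _).trans ?_
            rw [hny, norm_one]
      _ ≤ 4 * |y| ^ 3 := by linarith

lemma summable_sub_one_pow_mul (hP : IsCriticalLaw P Q) {k : ℕ} (hk : k ≤ 3) :
    Summable fun n : ℕ => |(n : ℝ) - 1| ^ k * PowerSeries.coeff n P := by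
  refine Summable.of_nonneg_of_le (fun n => mul_nonneg (by positivity) (hP.nonneg n))
    (fun n => ?_) (hP.third.add hP.summable)
  have h : |(n : ℝ) - 1| ^ k ≤ (n : ℝ) ^ 3 + 1 := by
    rcases n with _ | n
    · simp
    · push_cast
      rw [add_sub_cancel_right, abs_of_nonneg (by positivity)]
      calc (n : ℝ) ^ k ≤ (n + 1 : ℝ) ^ k := by gcongr; linarith
        _ ≤ (n + 1 : ℝ) ^ 3 := pow_le_pow_right₀ (by linarith [(n.cast_nonneg : (0 : ℝ) ≤ n)]) hk
        _ ≤ _ := by linarith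
  calc _ ≤ ((n : ℝ) ^ 3 + 1) * PowerSeries.coeff n P :=
        mul_le_mul_of_nonneg_right h (hP.nonneg n)
    _ = _ := by ring

lemma centredSecondMoment_pos (hP : IsCriticalLaw P Q) : 0 < centredSecondMoment P := by
  have h := summable_sub_one_pow_mul hP (k := 2) (by norm_num)
  simp only [sq_abs] at h
  refine h.tsum_pos (fun n => mul_nonneg (by positivity) (hP.nonneg n)) 0 ?_
  simpa using hP.zero_pos

/-- The second-order expansion at `0` of the characteristic function of the centred law. -/
lemma exists_norm_charFn_sub_taylor_le (hP : IsCriticalLaw P Q) :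
    ∃ K : ℝ, ∀ θ : ℝ, ‖charFn P θ * Complex.exp (-(θ * Complex.I)) -
      (1 - (centredSecondMoment P * θ ^ 2 / 2 : ℝ))‖ ≤ K * |θ| ^ 3 := by
  refine ⟨4 * ∑' n : ℕ, |(n : ℝ) - 1| ^ 3 * PowerSeries.coeff n P, fun θ => ?_⟩
  have h3 := summable_sub_one_pow_mul hP (k := 3) le_rfl
  have h2 := summable_sub_one_pow_mul hP (k := 2) (by norm_num)
  simp only [sq_abs] at h2
  have h1 : Summable fun n : ℕ => ((n : ℝ) - 1) * PowerSeries.coeff n P := by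
    refine Summable.of_norm ((summable_sub_one_pow_mul hP (k := 1) (by norm_num)).congr fun n => ?_)
    rw [norm_mul, Real.norm_of_nonneg (hP.nonneg n), Real.norm_eq_abs, pow_one]
  have e0 : HasSum (fun n => ((PowerSeries.coeff n P : ℝ) : ℂ)) 1 := by
    have := Complex.hasSum_ofReal.2 (hP.tsum_eq ▸ hP.summable.hasSum)
    simpa using this
  have e1 : HasSum (fun n : ℕ => ((((n : ℝ) - 1) * PowerSeries.coeff n P : ℝ) : ℂ)) 0 := by
    have := Complex.hasSum_ofReal.2 (hP.mean_eq ▸ h1.hasSum)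
    simpa only [Complex.ofReal_zero] using this
  have e2 : HasSum (fun n : ℕ => ((((n : ℝ) - 1) ^ 2 * PowerSeries.coeff n P : ℝ) : ℂ))
      (centredSecondMoment P : ℂ) := Complex.hasSum_ofReal.2 h2.hasSum
  have e3 : HasSum (fun n => ((PowerSeries.coeff n P : ℝ) : ℂ) * Complex.exp (θ * Complex.I) ^ n *
      Complex.exp (-(θ * Complex.I))) (charFn P θ * Complex.exp (-(θ * Complex.I))) :=
    (summable_norm_cis hP θ).of_norm.hasSum.mul_right _
  have e4 := e3.sub ((e0.add (e1.mul_left (θ * Complex.I))).sub (e2.mul_left ((θ : ℂ) ^ 2 / 2)))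
  have e5 : charFn P θ * Complex.exp (-(θ * Complex.I)) -
      (1 - (centredSecondMoment P * θ ^ 2 / 2 : ℝ)) =
      charFn P θ * Complex.exp (-(θ * Complex.I)) -
        (1 + θ * Complex.I * 0 - (θ : ℂ) ^ 2 / 2 * centredSecondMoment P) := by
    push_cast
    ring
  rw [e5, ← e4.tsum_eq]
  refine tsum_of_norm_bounded (((h3.hasSum.mul_left 4)).mul_right (|θ| ^ 3)) fun n => ?_
  have e6 : ((PowerSeries.coeff n P : ℝ) : ℂ) * Complex.exp (θ * Complex.I) ^ n *
      Complex.exp (-(θ * Complex.I)) - (((PowerSeries.coeff n P : ℝ) : ℂ) +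
        θ * Complex.I * ((((n : ℝ) - 1) * PowerSeries.coeff n P : ℝ) : ℂ) -
        (θ : ℂ) ^ 2 / 2 * ((((n : ℝ) - 1) ^ 2 * PowerSeries.coeff n P : ℝ) : ℂ)) =
      ((PowerSeries.coeff n P : ℝ) : ℂ) *
        (Complex.exp (((((n : ℝ) - 1) * θ : ℝ) : ℂ) * Complex.I) -
        (1 + ((((n : ℝ) - 1) * θ : ℝ) : ℂ) * Complex.I -
          ((((n : ℝ) - 1) * θ : ℝ) : ℂ) ^ 2 / 2)) := by
    have : Complex.exp (θ * Complex.I) ^ n * Complex.exp (-(θ * Complex.I)) =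
        Complex.exp (((((n : ℝ) - 1) * θ : ℝ) : ℂ) * Complex.I) := by
      rw [← Complex.exp_nat_mul, ← Complex.exp_add]
      congr 1
      push_cast
      ring
    rw [mul_assoc, this]
    push_cast
    ring
  rw [e6, norm_mul, Complex.norm_real, Real.norm_of_nonneg (hP.nonneg n)]
  calc _ ≤ PowerSeries.coeff n P * (4 * |((n : ℝ) - 1) * θ| ^ 3) :=
        mul_le_mul_of_nonneg_left (norm_cis_sub_taylor_le _) (hP.nonneg n)
    _ = _ := by
        rw [abs_mul, mul_pow]
        ring

/-- The central limit theorem at the level of characteristic functions. -/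
lemma tendsto_charFn_div_sqrt_pow (hP : IsCriticalLaw P Q) (x : ℝ) :
    Tendsto (fun n : ℕ => (charFn P (x / √n) * Complex.exp (-((x / √n : ℝ) * Complex.I))) ^ n)
      atTop (𝓝 ((Real.exp (-(centredSecondMoment P / 2) * x ^ 2) : ℝ) : ℂ)) := by
  obtain ⟨K, hK⟩ := exists_norm_charFn_sub_taylor_le hP
  rw [Complex.ofReal_exp]
  have hsqrt : Tendsto (fun n : ℕ => √(n : ℝ)) atTop atTop :=
    Real.tendsto_sqrt_atTop.comp tendsto_natCast_atTop_atTop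
  have h := Complex.tendsto_one_add_pow_exp_of_tendsto
    (g := fun n : ℕ => charFn P (x / √n) * Complex.exp (-((x / √n : ℝ) * Complex.I)) - 1)
    (t := ((-(centredSecondMoment P / 2) * x ^ 2 : ℝ) : ℂ)) ?_
  · simpa using h
  · rw [tendsto_iff_norm_sub_tendsto_zero]
    have hlim : Tendsto (fun n : ℕ => K * |x| ^ 3 * (√(n : ℝ))⁻¹) atTop (𝓝 0) := by
      simpa using (tendsto_inv_atTop_zero.comp hsqrt).const_mul (K * |x| ^ 3)
    refine squeeze_zero' (Eventually.of_forall fun n => norm_nonneg _) ?_ hlim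
    filter_upwards [eventually_gt_atTop 0] with n hn
    have hn0 : (0 : ℝ) < n := by exact_mod_cast hn
    have hs : 0 < √(n : ℝ) := Real.sqrt_pos.2 hn0
    have hss : √(n : ℝ) ^ 2 = n := Real.sq_sqrt hn0.le
    have e : (n : ℂ) * (charFn P (x / √n) * Complex.exp (-((x / √n : ℝ) * Complex.I)) - 1) -
        ((-(centredSecondMoment P / 2) * x ^ 2 : ℝ) : ℂ) =
        (n : ℂ) * (charFn P (x / √n) * Complex.exp (-((x / √n : ℝ) * Complex.I)) -
          (1 - (centredSecondMoment P * (x / √n) ^ 2 / 2 : ℝ))) := by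
      have : centredSecondMoment P * (x / √n) ^ 2 / 2 = centredSecondMoment P * x ^ 2 / 2 / n := by
        rw [div_pow, hss]
        ring
      have hn1 : (n : ℂ) ≠ 0 := by exact_mod_cast hn.ne'
      rw [this]
      push_cast
      field_simp
      ring
    rw [e, norm_mul, Complex.norm_natCast]
    calc (n : ℝ) * _ ≤ n * (K * |x / √n| ^ 3) := by gcongr; exact hK _
      _ = K * |x| ^ 3 * (√(n : ℝ))⁻¹ := by
          rw [abs_div, abs_of_pos hs, div_pow]
          nth_rewrite 1 [← hss]
          field_simp

/-- The local limit theorem at distance one from the mean: `√n P(Sₙ = n - 1)` has a positive limit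
along `n ≡ 1 (mod Q)`. -/
theorem exists_tendsto_sqrt_mul_coeff_pow (hP : IsCriticalLaw P Q) :
    ∃ κ : ℝ, 0 < κ ∧ Tendsto (fun n : ℕ => √n * PowerSeries.coeff (n - 1) (P ^ n))
      (atTop ⊓ 𝓟 {n : ℕ | n ≡ 1 [MOD Q]}) (𝓝 κ) := by
  have hQ : (0 : ℝ) < Q := by exact_mod_cast hP.period_pos
  have hpi := Real.pi_pos
  obtain ⟨c, hc0, hc⟩ := exists_norm_charFn_le_exp hP
  set v := centredSecondMoment P / 2 with hv
  have hv0 : 0 < v := by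
    have := centredSecondMoment_pos hP
    positivity
  set φ : ℝ → ℂ := fun θ => charFn P θ * Complex.exp (-(θ * Complex.I)) with hφ
  have hφc : Continuous φ := (continuous_charFn hP).mul (by fun_prop)
  have hφn : ∀ θ, ‖φ θ‖ = ‖charFn P θ‖ := fun θ => by
    rw [hφ]
    dsimp only
    rw [norm_mul, show -(θ * Complex.I) = ((-θ : ℝ) : ℂ) * Complex.I by push_cast; ring,
      norm_cis, mul_one]
  -- The integrand of the inversion formula after the substitution `θ = x / √n`. It makes sense for
  -- all `n`; only the identification with a coefficient needs `n ≡ 1 (mod Q)`.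
  set F : ℕ → ℝ → ℂ := fun n x => (Set.Ioc (-(Real.pi / Q * √n)) (Real.pi / Q * √n)).indicator
    (fun x => φ (x / √n) ^ n * Complex.exp ((x / √n : ℝ) * Complex.I)) x with hF
  have hsqrt : Tendsto (fun n : ℕ => √(n : ℝ)) atTop atTop :=
    Real.tendsto_sqrt_atTop.comp tendsto_natCast_atTop_atTop
  have hlim : Tendsto (fun n => ∫ x, F n x) atTop
      (𝓝 (∫ x : ℝ, ((Real.exp (-v * x ^ 2) : ℝ) : ℂ))) := by
    refine tendsto_integral_filter_of_dominated_convergence (fun x => Real.exp (-c * x ^ 2))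
      ?_ ?_ (integrable_exp_neg_mul_sq hc0) ?_
    · refine Eventually.of_forall fun n => ?_
      exact (Continuous.aestronglyMeasurable (by fun_prop)).indicator measurableSet_Ioc
    · filter_upwards [eventually_gt_atTop 0] with n hn
      refine ae_of_all _ fun x => ?_
      have hn0 : (0 : ℝ) < n := by exact_mod_cast hn
      have hs : 0 < √(n : ℝ) := Real.sqrt_pos.2 hn0
      rw [hF]
      dsimp only
      by_cases hx : x ∈ Set.Ioc (-(Real.pi / Q * √n)) (Real.pi / Q * √n)
      · rw [Set.indicator_of_mem hx, norm_mul, norm_cis, mul_one, norm_pow, hφn]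
        have h1 : |x / √n| ≤ Real.pi / Q := by
          rw [abs_div, abs_of_pos hs, div_le_iff₀ hs]
          exact abs_le.2 ⟨hx.1.le, hx.2⟩
        calc _ ≤ Real.exp (-c * (x / √n) ^ 2) ^ n := by gcongr; exact hc _ h1
          _ = Real.exp (-c * x ^ 2) := by
            rw [← Real.exp_nat_mul, div_pow, Real.sq_sqrt hn0.le]
            congr 1
            field_simp
      · rw [Set.indicator_of_notMem hx, norm_zero]
        positivity
    · refine ae_of_all _ fun x => ?_
      have h1 := tendsto_charFn_div_sqrt_pow hP x
      have h2 : Tendsto (fun n : ℕ => Complex.exp ((x / √n : ℝ) * Complex.I)) atTop (𝓝 1) := by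
        have h3 : Tendsto (fun n : ℕ => x / √(n : ℝ)) atTop (𝓝 0) := hsqrt.const_div_atTop x
        have h4 : Continuous fun y : ℝ => Complex.exp (y * Complex.I) := by fun_prop
        have h5 := (h4.tendsto 0).comp h3
        simpa [Function.comp_def] using h5
      have h6 := h1.mul h2
      rw [mul_one] at h6
      refine h6.congr' ?_
      have h7 := hsqrt.const_mul_atTop (show 0 < Real.pi / Q by positivity)
      filter_upwards [h7.eventually_gt_atTop |x|] with n hn
      rw [hF]
      dsimp only
      rw [Set.indicator_of_mem]
      exact ⟨(abs_lt.1 hn).1, (abs_lt.1 hn).2.le⟩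
  rw [integral_complex_ofReal, integral_gaussian] at hlim
  have hre := (Complex.continuous_re.tendsto _).comp hlim
  rw [Complex.ofReal_re] at hre
  refine ⟨Q / (2 * Real.pi) * √(Real.pi / v), by positivity, ?_⟩
  refine ((hre.mono_left inf_le_left).const_mul (Q / (2 * Real.pi))).congr' ?_
  have hev : ∀ᶠ n : ℕ in atTop ⊓ 𝓟 {n : ℕ | n ≡ 1 [MOD Q]}, 0 < n ∧ n ≡ 1 [MOD Q] :=
    ((eventually_gt_atTop 0).filter_mono inf_le_left).and
      ((eventually_principal.2 fun _ h => h).filter_mono inf_le_right)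
  filter_upwards [hev] with n hn
  obtain ⟨hn, hnQ⟩ := hn
  have hn0 : (0 : ℝ) < n := by exact_mod_cast hn
  have hs : 0 < √(n : ℝ) := Real.sqrt_pos.2 hn0
  have hd : Q ∣ n - 1 := (Nat.modEq_iff_dvd' hn).1 hnQ.symm
  have hI := integral_charFn_pow hP n hd
  have hFi : ∫ x, F n x =
      ((√n * (2 * Real.pi / Q * PowerSeries.coeff (n - 1) (P ^ n)) : ℝ) : ℂ) := by
    rw [Complex.ofReal_mul, ← hI, hF]
    dsimp only
    rw [integral_indicator measurableSet_Ioc, ← intervalIntegral.integral_of_le (by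
      have : 0 ≤ Real.pi / Q * √n := by positivity
      linarith)]
    have := intervalIntegral.integral_comp_div (a := -(Real.pi / Q * √n)) (b := Real.pi / Q * √n)
      (fun θ : ℝ => φ θ ^ n * Complex.exp (θ * Complex.I)) hs.ne'
    rw [this, neg_div, mul_div_cancel_right₀ _ hs.ne', Complex.real_smul]
    congr 1
    refine intervalIntegral.integral_congr fun θ _ => ?_
    rw [hφ]
    dsimp only
    rw [mul_pow, mul_assoc, ← Complex.exp_nat_mul, ← Complex.exp_add]
    congr 2
    rw [Nat.cast_sub hn]
    push_cast
    ring
  rw [Function.comp_apply, hFi, Complex.ofReal_re]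
  field_simp

end LocalLimit

/-! ### Sequences with a tail of order `n^{-3/2}` along a residue class -/

/-- `n → ∞` along `n ≡ r (mod Q)`. -/
def residueFilter (Q r : ℕ) : Filter ℕ :=
  atTop ⊓ 𝓟 {n : ℕ | n ≡ r [MOD Q]}

lemma residueFilter_le_atTop (Q r : ℕ) : residueFilter Q r ≤ atTop := inf_le_left

lemma eventually_modEq (Q r : ℕ) : ∀ᶠ n in residueFilter Q r, n ≡ r [MOD Q] :=
  (eventually_principal.2 fun _ h => h).filter_mono inf_le_right

lemma residueFilter_congr {Q r s : ℕ} (h : r ≡ s [MOD Q]) :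
    residueFilter Q r = residueFilter Q s := by
  have : {n : ℕ | n ≡ r [MOD Q]} = {n : ℕ | n ≡ s [MOD Q]} :=
    Set.ext fun n => ⟨fun hn => hn.trans h, fun hn => hn.trans h.symm⟩
  rw [residueFilter, residueFilter, this]

lemma tendsto_sub_residueFilter (Q r i : ℕ) :
    Tendsto (fun n => n - i) (residueFilter Q (i + r)) (residueFilter Q r) := by
  refine tendsto_inf.2 ⟨(tendsto_sub_atTop_nat i).mono_left inf_le_left, ?_⟩
  rw [tendsto_principal]
  filter_upwards [(eventually_ge_atTop i).filter_mono (residueFilter_le_atTop Q _),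
    eventually_modEq Q (i + r)] with n hn hm
  refine Nat.ModEq.add_left_cancel' i ?_
  rwa [Nat.add_sub_cancel' hn]

/-- The norming sequence `n^{3/2}`. -/
noncomputable def threeHalves (n : ℕ) : ℝ := n * √n

lemma threeHalves_nonneg (n : ℕ) : 0 ≤ threeHalves n := by
  unfold threeHalves
  positivity

lemma threeHalves_pos {n : ℕ} (hn : 0 < n) : 0 < threeHalves n := by
  unfold threeHalves
  have : (0 : ℝ) < n := by exact_mod_cast hn
  positivity

lemma threeHalves_mul (m n : ℕ) : threeHalves (m * n) = threeHalves m * threeHalves n := by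
  unfold threeHalves
  rw [Nat.cast_mul, Real.sqrt_mul (Nat.cast_nonneg m)]
  ring

lemma threeHalves_mono {m n : ℕ} (h : m ≤ n) : threeHalves m ≤ threeHalves n := by
  unfold threeHalves
  have : (m : ℝ) ≤ n := by exact_mod_cast h
  gcongr

lemma threeHalves_le_sq (n : ℕ) : threeHalves n ≤ (n : ℝ) ^ 2 := by
  unfold threeHalves
  rw [sq]
  refine mul_le_mul_of_nonneg_left ?_ (Nat.cast_nonneg n)
  rcases Nat.eq_zero_or_pos n with rfl | h
  · simp
  · have h1 : (1 : ℝ) ≤ n := by exact_mod_cast h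
    rw [Real.sqrt_le_left (by positivity)]
    nlinarith

lemma tendsto_threeHalves_add_div (i : ℕ) :
    Tendsto (fun n => threeHalves (n + i) / threeHalves n) atTop (𝓝 1) := by
  have h1 : Tendsto (fun n : ℕ => 1 + (i : ℝ) / n) atTop (𝓝 1) := by
    simpa using (tendsto_const_div_atTop_nhds_zero_nat (i : ℝ)).const_add 1
  have h2 := h1.mul h1.sqrt
  rw [Real.sqrt_one, mul_one] at h2
  refine h2.congr' ?_
  filter_upwards [eventually_gt_atTop 0] with n hn
  have hn0 : (0 : ℝ) < n := by exact_mod_cast hn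
  have : 1 + (i : ℝ) / n = ((n + i : ℕ) : ℝ) / n := by
    push_cast
    field_simp
  rw [this, Real.sqrt_div (Nat.cast_nonneg _), threeHalves, threeHalves, div_mul_div_comm]

lemma tendsto_threeHalves_div_sub (i : ℕ) :
    Tendsto (fun n => threeHalves n / threeHalves (n - i)) atTop (𝓝 1) := by
  refine ((tendsto_threeHalves_add_div i).comp (tendsto_sub_atTop_nat i)).congr' ?_
  filter_upwards [eventually_ge_atTop i] with n hn
  rw [Function.comp_apply, Nat.sub_add_cancel hn]

/-- The coefficients of `f` are nonnegative, supported on `n ≡ r (mod Q)`, have sum `s`, and are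
asymptotic to `c n^{-3/2}` along that residue class. -/
structure HasTail (Q r : ℕ) (f : PowerSeries ℝ) (s c : ℝ) : Prop where
  nonneg : ∀ n, 0 ≤ PowerSeries.coeff n f
  modEq : ∀ n, PowerSeries.coeff n f ≠ 0 → n ≡ r [MOD Q]
  hasSum : HasSum (fun n => PowerSeries.coeff n f) s
  tendsto : Tendsto (fun n => threeHalves n * PowerSeries.coeff n f) (residueFilter Q r) (𝓝 c)

section Tail

variable {Q r r' : ℕ} {f g : PowerSeries ℝ} {s s' c c' : ℝ}

/-- Off the residue class the coefficients vanish, so a limit along the class bounds all of them. -/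
lemma exists_threeHalves_mul_le (hm : ∀ n, PowerSeries.coeff n f ≠ 0 → n ≡ r [MOD Q])
    (ht : Tendsto (fun n => threeHalves n * PowerSeries.coeff n f) (residueFilter Q r) (𝓝 c)) :
    ∃ C : ℝ, 0 ≤ C ∧ ∀ n, threeHalves n * PowerSeries.coeff n f ≤ C := by
  have h1 : ∀ᶠ n in residueFilter Q r, threeHalves n * PowerSeries.coeff n f ≤ |c| + 1 :=
    (ht.eventually (gt_mem_nhds (show c < |c| + 1 by linarith [le_abs_self c]))).mono
      fun n h => le_of_lt h
  rw [residueFilter, eventually_inf_principal, eventually_atTop] at h1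
  obtain ⟨N, hN⟩ := h1
  refine ⟨|c| + 1 + ∑ n ∈ Finset.range N, |threeHalves n * PowerSeries.coeff n f|, by positivity,
    fun n => ?_⟩
  rcases lt_or_ge n N with h | h
  · have h2 := Finset.single_le_sum (f := fun n => |threeHalves n * PowerSeries.coeff n f|)
      (fun i _ => abs_nonneg _) (Finset.mem_range.2 h)
    have h3 := le_abs_self (threeHalves n * PowerSeries.coeff n f)
    linarith [abs_nonneg c]
  · have h2 : 0 ≤ ∑ n ∈ Finset.range N, |threeHalves n * PowerSeries.coeff n f| :=
      Finset.sum_nonneg fun i _ => abs_nonneg _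
    by_cases h0 : PowerSeries.coeff n f = 0
    · rw [h0, mul_zero]
      positivity
    · have := hN n h (hm n h0)
      linarith

lemma HasTail.exists_bound (hf : HasTail Q r f s c) :
    ∃ C : ℝ, 0 ≤ C ∧ ∀ n, threeHalves n * PowerSeries.coeff n f ≤ C :=
  exists_threeHalves_mul_le hf.modEq hf.tendsto

lemma HasTail.sum_nonneg (hf : HasTail Q r f s c) : 0 ≤ s :=
  hf.hasSum.nonneg hf.nonneg

lemma hasTail_one (Q : ℕ) : HasTail Q 0 1 1 0 where
  nonneg n := by
    rw [PowerSeries.coeff_one]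
    split_ifs <;> norm_num
  modEq n h := by
    have : n = 0 := by
      by_contra hn
      exact h (by rw [PowerSeries.coeff_one, if_neg hn])
    rw [this]
  hasSum := by
    simp_rw [PowerSeries.coeff_one]
    exact hasSum_ite_eq 0 1
  tendsto := by
    refine tendsto_const_nhds.congr fun n => ?_
    rw [PowerSeries.coeff_one]
    split_ifs with h
    · simp [h, threeHalves]
    · simp

/-- The part of the convolution in which the index of `f` is at most half of the total: only the
tail of `g` matters there. The predicate `p n i` stands for `2 * i ≤ n` or `2 * i < n`, so that the
two halves of a convolution do not overlap. -/
lemma HasTail.tendsto_half (hf : HasTail Q r f s c) (hg : HasTail Q r' g s' c')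
    (p : ℕ → ℕ → Prop) [∀ n i, Decidable (p n i)] (hp : ∀ n i, p n i → 2 * i ≤ n)
    (hp' : ∀ i, ∀ᶠ n in atTop, p n i) :
    Tendsto (fun n => threeHalves n * ∑ q ∈ Finset.HasAntidiagonal.antidiagonal n,
      if p n q.1 then PowerSeries.coeff q.1 f * PowerSeries.coeff q.2 g else 0)
      (residueFilter Q (r + r')) (𝓝 (c' * s)) := by
  obtain ⟨C, hC0, hC⟩ := hg.exists_bound
  have e : ∀ n, threeHalves n * ∑ q ∈ Finset.HasAntidiagonal.antidiagonal n,
      (if p n q.1 then PowerSeries.coeff q.1 f * PowerSeries.coeff q.2 g else 0) =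
      ∑' i, if p n i then PowerSeries.coeff i f *
        (threeHalves n * PowerSeries.coeff (n - i) g) else 0 := by
    intro n
    rw [Finset.Nat.sum_antidiagonal_eq_sum_range_succ
      (fun i j => if p n i then PowerSeries.coeff i f * PowerSeries.coeff j g else 0),
      Finset.mul_sum, tsum_eq_sum (s := Finset.range (n + 1))]
    · refine Finset.sum_congr rfl fun i _ => ?_
      split_ifs <;> ring
    · intro i hi
      rw [if_neg]
      intro h
      have := hp n i h
      rw [Finset.mem_range] at hi
      omega
  simp_rw [e]
  rw [← (hf.hasSum.mul_left c').tsum_eq]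
  refine tendsto_tsum_of_dominated_convergence
    (bound := fun i => PowerSeries.coeff i f * (threeHalves 2 * C)) (hf.hasSum.summable.mul_right _)
    (fun i => ?_) (Eventually.of_forall fun n i => ?_)
  · by_cases h0 : PowerSeries.coeff i f = 0
    · simpa [h0] using tendsto_const_nhds
    · have hi := hf.modEq i h0
      have h1 : Tendsto (fun n => threeHalves (n - i) * PowerSeries.coeff (n - i) g)
          (residueFilter Q (r + r')) (𝓝 c') := by
        rw [residueFilter_congr (hi.symm.add_right r')]
        exact hg.tendsto.comp (tendsto_sub_residueFilter Q r' i)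
      have h2 := ((tendsto_threeHalves_div_sub i).mono_left
        (residueFilter_le_atTop Q (r + r'))).mul h1
      have h3 := h2.const_mul (PowerSeries.coeff i f)
      rw [one_mul, mul_comm _ c'] at h3
      refine h3.congr' ?_
      filter_upwards [((hp' i).and (eventually_gt_atTop i)).filter_mono
        (residueFilter_le_atTop Q _)] with n hn
      have := (threeHalves_pos (Nat.sub_pos_of_lt hn.2)).ne'
      rw [if_pos hn.1]
      field_simp
  · have hfi := hf.nonneg i
    have h2 := threeHalves_nonneg 2
    split_ifs with h
    · have hgn := hg.nonneg (n - i)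
      have h3 := threeHalves_nonneg n
      rw [Real.norm_of_nonneg (by positivity)]
      refine mul_le_mul_of_nonneg_left ?_ hfi
      calc threeHalves n * PowerSeries.coeff (n - i) g
          ≤ threeHalves (2 * (n - i)) * PowerSeries.coeff (n - i) g := by
            refine mul_le_mul_of_nonneg_right (threeHalves_mono ?_) hgn
            have := hp n i h
            omega
        _ = threeHalves 2 * (threeHalves (n - i) * PowerSeries.coeff (n - i) g) := by
            rw [threeHalves_mul, mul_assoc]
        _ ≤ _ := mul_le_mul_of_nonneg_left (hC _) h2
    · rw [norm_zero]
      positivity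

lemma hasSum_coeff_mul (hf0 : ∀ n, 0 ≤ PowerSeries.coeff n f)
    (hg0 : ∀ n, 0 ≤ PowerSeries.coeff n g) (hf : HasSum (fun n => PowerSeries.coeff n f) s)
    (hg : HasSum (fun n => PowerSeries.coeff n g) s') :
    HasSum (fun n => PowerSeries.coeff n (f * g)) (s * s') := by
  have hf1 : Summable fun n => ‖((PowerSeries.coeff n f : ℝ) : ℝ) * 1 ^ n‖ := by
    simpa [abs_of_nonneg (hf0 _)] using hf.summable
  have hg1 : Summable fun n => ‖((PowerSeries.coeff n g : ℝ) : ℝ) * 1 ^ n‖ := by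
    simpa [abs_of_nonneg (hg0 _)] using hg.summable
  have h1 := summable_norm_coeff_mul (𝕜 := ℝ) (z := 1) hf1 hg1
  have h2 := value_mul (𝕜 := ℝ) (z := 1) hf1 hg1
  simp only [value_real, one_pow, mul_one, hf.tsum_eq, hg.tsum_eq] at h2
  rw [← h2]
  refine Summable.hasSum ?_
  simpa [abs_of_nonneg (coeff_mul_nonneg hf0 hg0 _)] using h1

lemma HasTail.mul (hf : HasTail Q r f s c) (hg : HasTail Q r' g s' c') :
    HasTail Q (r + r') (f * g) (s * s') (c * s' + c' * s) where
  nonneg := coeff_mul_nonneg hf.nonneg hg.nonneg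
  modEq := coeff_mul_modEq hf.modEq hg.modEq
  hasSum := hasSum_coeff_mul hf.nonneg hg.nonneg hf.hasSum hg.hasSum
  tendsto := by
    have h1 := hf.tendsto_half hg (fun n i => 2 * i ≤ n) (fun n i h => h)
      (fun i => eventually_ge_atTop (2 * i))
    have h2 := hg.tendsto_half hf (fun n i => 2 * i < n) (fun n i h => h.le)
      (fun i => eventually_gt_atTop (2 * i))
    rw [add_comm r' r] at h2
    rw [add_comm (c * s')]
    refine (h1.add h2).congr fun n => ?_
    rw [← mul_add, PowerSeries.coeff_mul]
    congr 1
    conv_lhs => rw [← Finset.Nat.sum_antidiagonal_swap (n := n)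
      (f := fun q => if 2 * q.1 < n then PowerSeries.coeff q.1 g * PowerSeries.coeff q.2 f else 0)]
    rw [← Finset.sum_add_distrib]
    refine Finset.sum_congr rfl fun q hq => ?_
    have hq' : q.1 + q.2 = n := Finset.HasAntidiagonal.mem_antidiagonal.1 hq
    by_cases h : 2 * q.1 ≤ n
    · rw [if_pos h, Prod.fst_swap, if_neg (by omega), add_zero]
    · rw [if_neg h, Prod.fst_swap, if_pos (by omega), zero_add, Prod.snd_swap, mul_comm]

lemma HasTail.pow (hf : HasTail Q 1 f s c) (d : ℕ) :
    HasTail Q d (f ^ d) (s ^ d) (c * (d * s ^ (d - 1))) := by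
  induction d with
  | zero => simpa using hasTail_one Q
  | succ d ih =>
    have h := ih.mul hf
    have e : c * (d * s ^ (d - 1)) * s + c * s ^ d =
        c * ((d + 1 : ℕ) * s ^ (d + 1 - 1)) := by
      rcases d with _ | d
      · simp
      · rw [Nat.add_sub_cancel, Nat.add_sub_cancel, pow_succ]
        push_cast
        ring
    rwa [e, ← pow_succ, ← pow_succ] at h

/-- A bound for convolution powers that is uniform in the exponent: among `d` indices with sum `n`
one is at least `n / d`. -/
lemma HasTail.exists_bound_pow (hf : HasTail Q 1 f s c) :
    ∃ C : ℝ, 0 ≤ C ∧ ∀ d n, threeHalves n * PowerSeries.coeff n (f ^ d) ≤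
      C * (d * threeHalves d * s ^ (d - 1)) := by
  obtain ⟨C, hC0, hC⟩ := hf.exists_bound
  have hs := hf.sum_nonneg
  refine ⟨C, hC0, fun d => ?_⟩
  rcases Nat.eq_zero_or_pos d with rfl | hd
  · intro n
    rw [pow_zero, PowerSeries.coeff_one]
    split_ifs with h
    · simp [h, threeHalves]
    · simp
  · induction d, hd using Nat.le_induction with
    | base =>
      intro n
      simpa [threeHalves] using hC n
    | succ d hd ih =>
      intro n
      have hfd := hf.pow d
      have hw := threeHalves_pos (show 0 < d from hd)
      have hw' := threeHalves_nonneg (d + 1)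
      rw [pow_succ f, PowerSeries.coeff_mul, Finset.mul_sum, Nat.add_sub_cancel]
      have hterm : ∀ p ∈ Finset.HasAntidiagonal.antidiagonal n,
          threeHalves n * (PowerSeries.coeff p.1 (f ^ d) * PowerSeries.coeff p.2 f) ≤
          threeHalves (d + 1) * C * PowerSeries.coeff p.1 (f ^ d) +
          threeHalves (d + 1) * C * (d * s ^ (d - 1)) * PowerSeries.coeff p.2 f := by
        intro p hp
        have hp' : p.1 + p.2 = n := Finset.HasAntidiagonal.mem_antidiagonal.1 hp
        have h1 := hfd.nonneg p.1
        have h2 := hf.nonneg p.2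
        -- Either the last index is at least `n / (d + 1)`, or the first `d` ones have a sum of at
        -- least `n d / (d + 1)` and the induction hypothesis applies.
        rcases le_or_gt n ((d + 1) * p.2) with h | h
        · have h3 : threeHalves n * PowerSeries.coeff p.2 f ≤ threeHalves (d + 1) * C := by
            calc _ ≤ threeHalves ((d + 1) * p.2) * PowerSeries.coeff p.2 f :=
                  mul_le_mul_of_nonneg_right (threeHalves_mono h) h2
              _ = threeHalves (d + 1) * (threeHalves p.2 * PowerSeries.coeff p.2 f) := by
                  rw [threeHalves_mul, mul_assoc]
              _ ≤ _ := mul_le_mul_of_nonneg_left (hC _) hw'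
          have h4 := mul_le_mul_of_nonneg_right h3 h1
          have h5 : 0 ≤ threeHalves (d + 1) * C * (d * s ^ (d - 1)) * PowerSeries.coeff p.2 f := by
            positivity
          linarith
        · have h0 : d * n ≤ (d + 1) * p.1 := by
            have : (d + 1) * p.1 + (d + 1) * p.2 = d * n + n := by
              rw [← mul_add, hp']
              ring
            omega
          have h3 : threeHalves n * PowerSeries.coeff p.1 (f ^ d) ≤
              threeHalves (d + 1) * C * (d * s ^ (d - 1)) := by
            refine le_of_mul_le_mul_left ?_ hw
            calc threeHalves d * (threeHalves n * PowerSeries.coeff p.1 (f ^ d))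
                = threeHalves (d * n) * PowerSeries.coeff p.1 (f ^ d) := by
                  rw [threeHalves_mul, mul_assoc]
              _ ≤ threeHalves ((d + 1) * p.1) * PowerSeries.coeff p.1 (f ^ d) :=
                  mul_le_mul_of_nonneg_right (threeHalves_mono h0) h1
              _ = threeHalves (d + 1) * (threeHalves p.1 * PowerSeries.coeff p.1 (f ^ d)) := by
                  rw [threeHalves_mul, mul_assoc]
              _ ≤ threeHalves (d + 1) * (C * (d * threeHalves d * s ^ (d - 1))) :=
                  mul_le_mul_of_nonneg_left (ih _) hw'
              _ = _ := by ring
          have h4 := mul_le_mul_of_nonneg_right h3 h2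
          have h5 : 0 ≤ threeHalves (d + 1) * C * PowerSeries.coeff p.1 (f ^ d) := by positivity
          linarith
      have hpart : ∀ {h : PowerSeries ℝ} {t : ℝ}, (∀ n, 0 ≤ PowerSeries.coeff n h) →
          HasSum (fun n => PowerSeries.coeff n h) t →
          ∑ i ∈ Finset.range (n + 1), PowerSeries.coeff i h ≤ t := fun h0 ht =>
        sum_le_hasSum _ (fun i _ => h0 i) ht
      have hs1 := hpart hfd.nonneg hfd.hasSum
      have hs2 := hpart hf.nonneg hf.hasSum
      refine (Finset.sum_le_sum hterm).trans ?_
      rw [Finset.sum_add_distrib, ← Finset.mul_sum, ← Finset.mul_sum,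
        Finset.Nat.sum_antidiagonal_eq_sum_range_succ (fun i _ => PowerSeries.coeff i (f ^ d)),
        ← Finset.Nat.sum_antidiagonal_swap, Finset.Nat.sum_antidiagonal_eq_sum_range_succ
          (fun i j => PowerSeries.coeff (i, j).swap.2 f)]
      calc _ ≤ threeHalves (d + 1) * C * s ^ d +
            threeHalves (d + 1) * C * (d * s ^ (d - 1)) * s := by
            refine add_le_add (mul_le_mul_of_nonneg_left hs1 (by positivity))
              (mul_le_mul_of_nonneg_left hs2 (by positivity))
        _ = _ := by
            obtain ⟨e, rfl⟩ : ∃ e, d = e + 1 := ⟨d - 1, by omega⟩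
            rw [Nat.add_sub_cancel, pow_succ]
            push_cast
            ring

/-- Tails under composition: if `g = ρ z β(f)`, then the constant of the tail gets multiplied by
`ρ β'(s)`. -/
lemma HasTail.comp (hf : HasTail Q 1 f s c) (hf0 : PowerSeries.coeff 0 f = 0) {β : ℕ → ℝ}
    (hβ : ∀ d, 0 ≤ β d) (hβQ : ∀ d, β d ≠ 0 → Q ∣ d) (hβ1 : Summable fun d => β d * s ^ d)
    (hβ3 : Summable fun d : ℕ => β d * (d * threeHalves d * s ^ (d - 1))) {ρ : ℝ} (hρ : 0 ≤ ρ)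
    (hg0 : PowerSeries.coeff 0 g = 0)
    (hg : ∀ n, PowerSeries.coeff (n + 1) g =
      ρ * ∑ d ∈ Finset.range (n + 1), β d * PowerSeries.coeff n (f ^ d)) :
    HasTail Q 1 g (ρ * ∑' d, β d * s ^ d) (ρ * (∑' d, β d * (d * s ^ (d - 1))) * c) := by
  have hs := hf.sum_nonneg
  have hgt : ∀ n, PowerSeries.coeff (n + 1) g =
      ρ * ∑' d, β d * PowerSeries.coeff n (f ^ d) := by
    intro n
    rw [hg, tsum_eq_sum (s := Finset.range (n + 1))]
    intro d hd
    rw [Finset.mem_range, not_lt] at hd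
    rw [coeff_pow_eq_zero_of_lt hf0 (by omega), mul_zero]
  have hnn : ∀ d n, 0 ≤ β d * PowerSeries.coeff n (f ^ d) := fun d n =>
    mul_nonneg (hβ d) ((hf.pow d).nonneg n)
  refine ⟨fun n => ?_, fun n hn => ?_, ?_, ?_⟩
  · rcases n with _ | n
    · exact hg0.ge
    · rw [hg]
      exact mul_nonneg hρ (Finset.sum_nonneg fun d _ => hnn d n)
  · rcases n with _ | n
    · exact absurd hg0 hn
    · rw [hg] at hn
      obtain ⟨d, -, hd⟩ := Finset.exists_ne_zero_of_sum_ne_zero (right_ne_zero_of_mul hn)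
      have h1 := (hf.pow d).modEq n (right_ne_zero_of_mul hd)
      have h2 := Nat.modEq_zero_iff_dvd.2 (hβQ d (left_ne_zero_of_mul hd))
      simpa using (h1.trans h2).add_right 1
  · have hrow : ∀ d, HasSum (fun n => β d * PowerSeries.coeff n (f ^ d)) (β d * s ^ d) := fun d =>
      (hf.pow d).hasSum.mul_left _
    have hS : Summable fun p : ℕ × ℕ => β p.1 * PowerSeries.coeff p.2 (f ^ p.1) := by
      rw [summable_prod_of_nonneg fun p => hnn p.1 p.2]
      refine ⟨fun d => (hrow d).summable, ?_⟩
      simp_rw [(hrow _).tsum_eq]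
      exact hβ1
    have hT : HasSum (fun n => ∑' d, β d * PowerSeries.coeff n (f ^ d)) (∑' d, β d * s ^ d) := by
      have h1 : Summable fun n => ∑' d, β d * PowerSeries.coeff n (f ^ d) := hS.prod_symm.prod
      have h2 := Summable.tsum_comm (f := fun d n => β d * PowerSeries.coeff n (f ^ d)) hS
      simp_rw [(hrow _).tsum_eq] at h2
      rw [← h2]
      exact h1.hasSum
    have h3 := hT.mul_left ρ
    simp_rw [← hgt] at h3
    have h4 := (hasSum_nat_add_iff (f := fun n => PowerSeries.coeff n g) 1).1 h3
    simpa [hg0] using h4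
  · obtain ⟨C, hC0, hC⟩ := hf.exists_bound_pow
    have h1 : Tendsto (fun n => ∑' d, β d * (threeHalves n * PowerSeries.coeff n (f ^ d)))
        (residueFilter Q 0) (𝓝 (∑' d, β d * (c * (d * s ^ (d - 1))))) := by
      refine tendsto_tsum_of_dominated_convergence (hβ3.mul_left C) (fun d => ?_)
        (Eventually.of_forall fun n d => ?_)
      · by_cases h0 : β d = 0
        · simpa [h0] using tendsto_const_nhds
        · rw [residueFilter_congr (Nat.modEq_zero_iff_dvd.2 (hβQ d h0)).symm]
          exact (hf.pow d).tendsto.const_mul _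
      · have := hβ d
        have h2 := (hf.pow d).nonneg n
        have h3 := threeHalves_nonneg n
        rw [Real.norm_of_nonneg (by positivity)]
        calc _ ≤ β d * (C * (d * threeHalves d * s ^ (d - 1))) :=
              mul_le_mul_of_nonneg_left (hC d n) (hβ d)
          _ = _ := by ring
    have h2 := (((tendsto_threeHalves_add_div 1).mono_left
      (residueFilter_le_atTop Q 0)).mul h1).const_mul ρ
    have h3 := h2.comp (tendsto_sub_residueFilter Q 0 1)
    have e : ρ * (1 * ∑' d, β d * (c * (d * s ^ (d - 1)))) =
        ρ * (∑' d, β d * (d * s ^ (d - 1))) * c := by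
      rw [one_mul, mul_assoc, ← tsum_mul_right]
      congr 1
      exact tsum_congr fun d => by ring
    rw [e, add_zero] at h3
    refine h3.congr' ?_
    filter_upwards [(eventually_gt_atTop 1).filter_mono (residueFilter_le_atTop Q 1)] with n hn
    obtain ⟨m, rfl⟩ : ∃ m, n = m + 1 := ⟨n - 1, by omega⟩
    have hm := (threeHalves_pos (show 0 < m by omega)).ne'
    have e2 : ∑' d, β d * (threeHalves m * PowerSeries.coeff m (f ^ d)) =
        threeHalves m * ∑' d, β d * PowerSeries.coeff m (f ^ d) := by
      rw [← tsum_mul_left]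
      exact tsum_congr fun d => by ring
    rw [Function.comp_apply, Nat.add_sub_cancel, e2, hgt]
    field_simp

/-- Partial sums of powers are at most powers of partial sums. -/
lemma sum_range_coeff_pow_le (hf : ∀ n, 0 ≤ PowerSeries.coeff n f) (N d : ℕ) :
    ∑ n ∈ Finset.range N, PowerSeries.coeff n (f ^ d) ≤
      (∑ n ∈ Finset.range N, PowerSeries.coeff n f) ^ d := by
  induction d with
  | zero =>
    simp only [pow_zero, PowerSeries.coeff_one]
    rw [Finset.sum_ite_eq' (Finset.range N) 0]
    split_ifs <;> norm_num
  | succ d ih =>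
    have hfd := coeff_pow_nonneg hf d
    have h1 : ∑ n ∈ Finset.range N, PowerSeries.coeff n (f ^ (d + 1)) ≤
        ∑ p ∈ Finset.range N ×ˢ Finset.range N,
          PowerSeries.coeff p.1 (f ^ d) * PowerSeries.coeff p.2 f := by
      refine le_trans (le_of_eq ?_) (Finset.sum_le_sum_of_subset_of_nonneg
        (Finset.filter_subset (fun p => p.1 + p.2 < N) _)
        fun p _ _ => mul_nonneg (hfd _) (hf _))
      rw [← Finset.sum_fiberwise_of_maps_to (t := Finset.range N)
        (g := fun p : ℕ × ℕ => p.1 + p.2)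
        (fun p hp => Finset.mem_range.2 (Finset.mem_filter.1 hp).2)]
      refine Finset.sum_congr rfl fun n hn => ?_
      rw [pow_succ f, PowerSeries.coeff_mul]
      refine Finset.sum_congr (Finset.ext fun p => ?_) fun _ _ => rfl
      rw [Finset.mem_range] at hn
      simp only [Finset.HasAntidiagonal.mem_antidiagonal, Finset.mem_filter, Finset.mem_product,
        Finset.mem_range]
      omega
    rw [Finset.sum_product] at h1
    dsimp only at h1
    rw [← Finset.sum_mul_sum] at h1
    rw [pow_succ (∑ n ∈ Finset.range N, PowerSeries.coeff n f)]
    exact h1.trans (mul_le_mul_of_nonneg_right ih (Finset.sum_nonneg fun n _ => hf n))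

end Tail

/-! ### The period and the Khinchin law at the apex -/

lemma bddAbove_period (hψ : IsK ψ) :
    BddAbove {d : ℕ | ∀ n : ℕ, 0 < n → 0 < PowerSeries.coeff n ψ → d ∣ n} := by
  obtain ⟨n, hn, hne⟩ := hψ.nonconstant
  exact ⟨n, fun d hd => Nat.le_of_dvd hn (hd n hn (lt_of_le_of_ne (hψ.coeff_nonneg n) hne.symm))⟩

lemma period_pos (hψ : IsK ψ) : 0 < period ψ :=
  le_csSup (bddAbove_period hψ) (fun n _ _ => one_dvd n)

lemma period_dvd (hψ : IsK ψ) {n : ℕ} (hn : 0 < PowerSeries.coeff n ψ) : period ψ ∣ n := by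
  rcases Nat.eq_zero_or_pos n with rfl | h0
  · exact dvd_zero _
  · have hne : {d : ℕ | ∀ n : ℕ, 0 < n → 0 < PowerSeries.coeff n ψ → d ∣ n}.Nonempty :=
      ⟨1, fun n _ _ => one_dvd n⟩
    exact Nat.sSup_mem hne (bddAbove_period hψ) n h0 hn

lemma dvd_period (hψ : IsK ψ) {d : ℕ} (hd : ∀ n, 0 < PowerSeries.coeff n ψ → d ∣ n) :
    d ∣ period ψ := by
  have h1 : Nat.lcm d (period ψ) ≤ period ψ :=
    le_csSup (bddAbove_period hψ) fun n _ hn => Nat.lcm_dvd (hd n hn) (period_dvd hψ hn)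
  have h2 := Nat.le_antisymm h1
    (Nat.le_of_dvd (Nat.lcm_pos (Nat.pos_of_ne_zero fun h0 => ?_) (period_pos hψ))
      (Nat.dvd_lcm_right _ _))
  · exact h2 ▸ Nat.dvd_lcm_left d (period ψ)
  · obtain ⟨n, hn, hne⟩ := hψ.nonconstant
    have := hd n (lt_of_le_of_ne (hψ.coeff_nonneg n) hne.symm)
    rw [h0, zero_dvd_iff] at this
    omega

lemma coeff_ne_zero_dvd (hψ : IsK ψ) {n : ℕ} (hn : PowerSeries.coeff n ψ ≠ 0) : period ψ ∣ n :=
  period_dvd hψ (lt_of_le_of_ne (hψ.coeff_nonneg n) hn.symm)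

/-- The generating function of the Khinchin variable `Y_t`. -/
noncomputable def khinchinSeries (ψ : PowerSeries ℝ) (t : ℝ) : PowerSeries ℝ :=
  PowerSeries.mk (khinchinProb ψ t)

lemma coeff_khinchinSeries_pow (ψ : PowerSeries ℝ) (t : ℝ) (n m : ℕ) :
    PowerSeries.coeff m (khinchinSeries ψ t ^ n) =
      PowerSeries.coeff m (ψ ^ n) * t ^ m / value ψ t ^ n := by
  have h : khinchinSeries ψ t = PowerSeries.C (value ψ t)⁻¹ * PowerSeries.rescale t ψ := by
    ext j
    rw [khinchinSeries, PowerSeries.coeff_mk, PowerSeries.coeff_C_mul, PowerSeries.coeff_rescale,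
      khinchinProb]
    ring
  rw [h, mul_pow, ← map_pow, ← map_pow, PowerSeries.coeff_C_mul, PowerSeries.coeff_rescale,
    inv_pow]
  ring

lemma khinchinProb_pos_iff (hψ : IsK ψ) {t : ℝ} (ht0 : 0 < t) (ht : ENNReal.ofReal t < radius ψ)
    (n : ℕ) : 0 < khinchinProb ψ t n ↔ 0 < PowerSeries.coeff n ψ := by
  have h1 := value_pos hψ ht0.le ht
  rw [khinchinProb, div_pos_iff_of_pos_right h1, mul_pos_iff_of_pos_right (by positivity)]

lemma isCriticalLaw_khinchinSeries (hψ : IsK ψ) {τ : ℝ} (hτ : IsApex ψ τ) :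
    IsCriticalLaw (khinchinSeries ψ τ) (period ψ) := by
  have hv := value_pos hψ hτ.pos.le hτ.lt_radius
  have hc : ∀ n, PowerSeries.coeff n (khinchinSeries ψ τ) = khinchinProb ψ τ n := fun n =>
    PowerSeries.coeff_mk _ _
  have hpos := khinchinProb_pos_iff hψ hτ.pos hτ.lt_radius
  have hS := summable_coeff_mul_pow hψ hτ.pos.le hτ.lt_radius
  refine ⟨?_, ?_, ?_, ?_, ?_, ?_, period_pos hψ, ?_, ?_⟩ <;> simp only [hc]
  · intro n
    have := hψ.coeff_nonneg n
    have := hτ.pos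
    unfold khinchinProb
    positivity
  · exact (hpos 0).2 hψ.coeff_zero_pos
  · exact hS.div_const _
  · simp only [khinchinProb]
    rw [tsum_div_const, ← value_real, div_self hv.ne']
  · have h := tsum_sub_one_mul hψ hτ.pos.le hτ.lt_radius
    rw [hτ.mean_eq_one, sub_self, zero_mul] at h
    simp only [khinchinProb, ← mul_div_assoc]
    rw [tsum_div_const, h, zero_div]
  · refine ((summable_pow_mul_coeff_mul_pow hψ 3 hτ.pos.le hτ.lt_radius).div_const
      (value ψ τ)).congr fun n => ?_
    rw [khinchinProb]
    ring
  · exact fun n hn => period_dvd hψ ((hpos n).1 hn)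
  · exact fun d hd => dvd_period hψ fun n hn => hd n ((hpos n).2 hn)

/-! ### The series of trees with `∂ ≥ k` at the singularity -/

lemma weight_nonneg (hψ : IsK ψ) (a : Finset (List ℕ)) : 0 ≤ weight ψ a :=
  Finset.prod_nonneg fun _ _ => hψ.coeff_nonneg _

lemma A_nonneg (hψ : IsK ψ) (n : ℕ) : 0 ≤ A ψ n :=
  Finset.sum_nonneg fun a _ => weight_nonneg hψ a

lemma ABorder_nonneg (hψ : IsK ψ) (k n : ℕ) : 0 ≤ ABorder ψ k n :=
  Finset.sum_nonneg fun a _ => weight_nonneg hψ a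

lemma ABorder_le (hψ : IsK ψ) (k n : ℕ) : ABorder ψ k n ≤ A ψ n :=
  Finset.sum_le_sum_of_subset_of_nonneg (Finset.filter_subset _ _)
    fun a _ _ => weight_nonneg hψ a

/-- By Lagrange's formula, `Aₙ = 0` unless `n ≡ 1 (mod Q_ψ)`. -/
lemma A_modEq (hψ : IsK ψ) {n : ℕ} (hn : A ψ n ≠ 0) : n ≡ 1 [MOD period ψ] := by
  rcases n with _ | n
  · exact absurd (by rw [← ABorder_zero_left, ABorder_zero_right]) hn
  · have h1 := succ_mul_A_succ ψ n
    have h2 : PowerSeries.coeff n (ψ ^ (n + 1)) ≠ 0 := by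
      rw [← h1]
      exact mul_ne_zero (by positivity) hn
    have h3 := coeff_pow_modEq (r := 0)
      (fun j hj => Nat.modEq_zero_iff_dvd.2 (coeff_ne_zero_dvd hψ hj)) _ n h2
    rw [mul_zero] at h3
    simpa using h3.add_right 1

/-- The series of trees with `∂ ≥ k`, rescaled so that its radius of convergence is `1`. -/
noncomputable def scaledSeries (ψ : PowerSeries ℝ) (ρ : ℝ) (k : ℕ) : PowerSeries ℝ :=
  PowerSeries.rescale ρ (borderSeries ψ k)

lemma coeff_scaledSeries (ψ : PowerSeries ℝ) (ρ : ℝ) (k n : ℕ) :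
    PowerSeries.coeff n (scaledSeries ψ ρ k) = ρ ^ n * ABorder ψ k n := by
  rw [scaledSeries, PowerSeries.coeff_rescale, coeff_borderSeries]

lemma coeff_zero_scaledSeries (ψ : PowerSeries ℝ) (ρ : ℝ) (k : ℕ) :
    PowerSeries.coeff 0 (scaledSeries ψ ρ k) = 0 := by
  rw [coeff_scaledSeries, ABorder_zero_right, mul_zero]

lemma coeff_scaledSeries_pow (ψ : PowerSeries ℝ) (ρ : ℝ) (k n d : ℕ) :
    PowerSeries.coeff n (scaledSeries ψ ρ k ^ d) =
      ρ ^ n * PowerSeries.coeff n (borderSeries ψ k ^ d) := by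
  rw [scaledSeries, ← map_pow, PowerSeries.coeff_rescale]

/-- `Aₙ ρⁿ ~ κ n^{-3/2}` along `n ≡ 1 (mod Q_ψ)`: Lagrange's formula expresses `Aₙ ρⁿ` as
`(τ / n) P(Sₙ = n - 1)`, where `Sₙ` is a sum of `n` independent copies of `Y_τ`. -/
lemma exists_tendsto_threeHalves_mul_A (hψ : IsK ψ) {τ ρ : ℝ} (hτ : IsApex ψ τ)
    (hρ : ρ = τ / value ψ τ) :
    ∃ κ : ℝ, 0 < κ ∧ Tendsto (fun n => threeHalves n *
      PowerSeries.coeff n (scaledSeries ψ ρ 0)) (residueFilter (period ψ) 1) (𝓝 κ) := by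
  obtain ⟨κ, hκ, hlim⟩ := exists_tendsto_sqrt_mul_coeff_pow (isCriticalLaw_khinchinSeries hψ hτ)
  have hτ0 := hτ.pos
  have hv := value_pos hψ hτ.pos.le hτ.lt_radius
  refine ⟨τ * κ, by positivity, (hlim.const_mul τ).congr' ?_⟩
  filter_upwards [(eventually_gt_atTop 0).filter_mono (residueFilter_le_atTop (period ψ) 1)]
    with n hn
  obtain ⟨m, rfl⟩ : ∃ m, n = m + 1 := ⟨n - 1, by omega⟩
  rw [coeff_khinchinSeries_pow, Nat.add_sub_cancel, ← succ_mul_A_succ, coeff_scaledSeries,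
    ABorder_zero_left, hρ, threeHalves, div_pow, pow_succ τ m]
  push_cast
  field_simp

lemma summable_of_threeHalves_mul_le {a : ℕ → ℝ} (ha : ∀ n, 0 ≤ a n) (ha0 : a 0 = 0) {C : ℝ}
    (hC : ∀ n, threeHalves n * a n ≤ C) : Summable a := by
  have h : Summable fun n : ℕ => C * ((n : ℝ) ^ (3 / 2 : ℝ))⁻¹ :=
    (Real.summable_nat_rpow_inv.2 (by norm_num)).mul_left C
  refine Summable.of_nonneg_of_le ha (fun n => ?_) h
  rcases Nat.eq_zero_or_pos n with rfl | hn
  · rw [ha0, Nat.cast_zero, Real.zero_rpow (by norm_num), inv_zero, mul_zero]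
  · have hn0 : (0 : ℝ) < n := by exact_mod_cast hn
    have e : threeHalves n = (n : ℝ) ^ (3 / 2 : ℝ) := by
      rw [threeHalves, Real.sqrt_eq_rpow, show (3 / 2 : ℝ) = 1 + 1 / 2 by norm_num,
        Real.rpow_add hn0, Real.rpow_one]
    rw [← div_eq_mul_inv, le_div_iff₀ (by positivity), ← e, mul_comm]
    exact hC n

/-- The partial sums of `T(ρ)` stay below `τ`, because `x ↦ ρ ψ(x)` maps `[0, τ]` into itself. -/
lemma sum_range_scaledSeries_le (hψ : IsK ψ) {τ ρ : ℝ} (hτ : IsApex ψ τ)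
    (hρ : ρ = τ / value ψ τ) (N : ℕ) :
    ∑ n ∈ Finset.range N, PowerSeries.coeff n (scaledSeries ψ ρ 0) ≤ τ := by
  have hτ0 := hτ.pos
  have hv := value_pos hψ hτ.pos.le hτ.lt_radius
  have hρ0 : 0 < ρ := by rw [hρ]; positivity
  have hnn : ∀ n, 0 ≤ PowerSeries.coeff n (scaledSeries ψ ρ 0) := fun n => by
    rw [coeff_scaledSeries]
    have := ABorder_nonneg hψ 0 n
    positivity
  induction N with
  | zero => simpa using hτ0.le
  | succ N ih =>
    set f := scaledSeries ψ ρ 0 with hf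
    rw [Finset.sum_range_succ', hf, coeff_zero_scaledSeries, add_zero, ← hf]
    have h1 : ∀ n ∈ Finset.range N, PowerSeries.coeff (n + 1) f =
        ρ * ∑ d ∈ Finset.range N, PowerSeries.coeff d ψ * PowerSeries.coeff n (f ^ d) := by
      intro n hn
      rw [Finset.mem_range] at hn
      rw [hf, coeff_scaledSeries, ABorder_zero_left, A_succ, pow_succ', mul_assoc, Finset.mul_sum]
      congr 1
      refine Finset.sum_subset_zero_on_sdiff (Finset.range_mono (by omega)) (fun d hd => ?_)
        fun d _ => ?_
      · rw [Finset.mem_sdiff, Finset.mem_range, Finset.mem_range] at hd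
        rw [coeff_pow_eq_zero_of_lt (coeff_zero_scaledSeries ψ ρ 0) (by omega), mul_zero]
      · rw [coeff_scaledSeries_pow]
        ring
    rw [Finset.sum_congr rfl h1, ← Finset.mul_sum, Finset.sum_comm]
    simp_rw [← Finset.mul_sum]
    have h2 : ∑ d ∈ Finset.range N, PowerSeries.coeff d ψ *
        ∑ n ∈ Finset.range N, PowerSeries.coeff n (f ^ d) ≤ value ψ τ := by
      rw [value_real]
      refine le_trans (Finset.sum_le_sum fun d _ => ?_)
        ((summable_coeff_mul_pow hψ hτ0.le hτ.lt_radius).sum_le_tsum (Finset.range N)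
          fun d _ => mul_nonneg (hψ.coeff_nonneg d) (by positivity))
      refine mul_le_mul_of_nonneg_left ?_ (hψ.coeff_nonneg d)
      exact (sum_range_coeff_pow_le hnn N d).trans
        (pow_le_pow_left₀ (Finset.sum_nonneg fun n _ => hnn n) ih d)
    calc _ ≤ ρ * value ψ τ := mul_le_mul_of_nonneg_left h2 hρ0.le
      _ = τ := by rw [hρ, div_mul_cancel₀ _ hv.ne']

section Compose

variable {τ ρ s : ℝ}

lemma summable_coeff_mul_deriv_weight (hψ : IsK ψ) (hτ : IsApex ψ τ) (hs0 : 0 ≤ s) (hs : s ≤ τ) :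
    Summable fun d : ℕ => PowerSeries.coeff d ψ * (d * threeHalves d * s ^ (d - 1)) := by
  have hτ0 := hτ.pos
  refine Summable.of_nonneg_of_le (fun d => ?_) (fun d => ?_)
    ((summable_pow_mul_coeff_mul_pow hψ 3 hτ0.le hτ.lt_radius).mul_left τ⁻¹)
  · have := hψ.coeff_nonneg d
    have := threeHalves_nonneg d
    positivity
  · rcases d with _ | d
    · simp
    · have hb := hψ.coeff_nonneg (d + 1)
      have hw := threeHalves_nonneg (d + 1)
      rw [Nat.add_sub_cancel]
      calc _ ≤ PowerSeries.coeff (d + 1) ψ *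
            (((d + 1 : ℕ) : ℝ) * ((d + 1 : ℕ) : ℝ) ^ 2 * τ ^ d) := by
            gcongr
            exact threeHalves_le_sq (d + 1)
        _ = _ := by
            rw [pow_succ τ d]
            field_simp

/-- One step of the recursion `T_{k+1} = z (ψ(T_k) - b₀)`, for the sum and for the tail. -/
lemma HasTail.scaledSeries_succ (hψ : IsK ψ) (hτ : IsApex ψ τ) (hρ : 0 ≤ ρ) {k : ℕ} {c : ℝ}
    (hs : s ≤ τ) (h : HasTail (period ψ) 1 (scaledSeries ψ ρ k) s c) :
    HasTail (period ψ) 1 (scaledSeries ψ ρ (k + 1))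
      (ρ * (value ψ s - PowerSeries.coeff 0 ψ))
      (ρ * (∑' d : ℕ, PowerSeries.coeff d ψ * (d * s ^ (d - 1))) * c) := by
  have hs0 := h.sum_nonneg
  have hsr : ENNReal.ofReal s < radius ψ := (ENNReal.ofReal_le_ofReal hs).trans_lt hτ.lt_radius
  -- The coefficients of `ψ - b₀`.
  set β : ℕ → ℝ := fun d => if d = 0 then 0 else PowerSeries.coeff d ψ with hβ
  have hβle : ∀ d, β d ≤ PowerSeries.coeff d ψ := fun d => by
    rw [hβ]
    dsimp only
    split_ifs with h
    · exact hψ.coeff_nonneg d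
    · exact le_rfl
  have hβ0 : ∀ d, 0 ≤ β d := fun d => by
    rw [hβ]
    dsimp only
    split_ifs with h
    · exact le_rfl
    · exact hψ.coeff_nonneg d
  have hS := summable_coeff_mul_pow hψ hs0 hsr
  have e1 : ∑' d, β d * s ^ d = value ψ s - PowerSeries.coeff 0 ψ := by
    rw [value_real, hS.tsum_eq_zero_add, pow_zero, mul_one, add_sub_cancel_left]
    rw [Summable.tsum_eq_zero_add (Summable.of_nonneg_of_le
      (fun d => mul_nonneg (hβ0 d) (by positivity))
      (fun d => mul_le_mul_of_nonneg_right (hβle d) (by positivity)) hS)]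
    simp [hβ]
  have e2 : ∀ d : ℕ, β d * (d * s ^ (d - 1)) = PowerSeries.coeff d ψ * (d * s ^ (d - 1)) := by
    rintro (_ | d)
    · simp
    · simp [hβ]
  rw [← e1]
  simp_rw [← e2]
  refine h.comp (coeff_zero_scaledSeries ψ ρ k) hβ0 (fun d hd => ?_) ?_ ?_ hρ
    (coeff_zero_scaledSeries ψ ρ (k + 1)) fun n => ?_
  · refine coeff_ne_zero_dvd hψ fun h0 => hd ?_
    rw [hβ]
    dsimp only
    rw [h0, ite_self]
  · exact Summable.of_nonneg_of_le (fun d => mul_nonneg (hβ0 d) (by positivity))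
      (fun d => mul_le_mul_of_nonneg_right (hβle d) (by positivity)) hS
  · have hw : ∀ d : ℕ, 0 ≤ (d : ℝ) * threeHalves d * s ^ (d - 1) := fun d => by
      have := threeHalves_nonneg d
      positivity
    exact Summable.of_nonneg_of_le (fun d => mul_nonneg (hβ0 d) (hw d))
      (fun d => mul_le_mul_of_nonneg_right (hβle d) (hw d))
      (summable_coeff_mul_deriv_weight hψ hτ hs0 hs)
  · rw [coeff_scaledSeries, ABorder_succ, pow_succ', mul_assoc, Finset.mul_sum]
    congr 1
    refine Finset.sum_congr rfl fun d _ => ?_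
    rw [coeff_scaledSeries_pow, hβ]
    dsimp only
    split_ifs <;> ring

/-- The tree series has the value `τ` at `ρ`: its value `s` there is at most `τ` and solves
`s = ρ ψ(s)`, and `τ` is the only solution. -/
lemma exists_hasTail_scaledSeries_zero (hψ : IsK ψ) (hτ : IsApex ψ τ) (hρ : ρ = τ / value ψ τ) :
    ∃ κ : ℝ, 0 < κ ∧ HasTail (period ψ) 1 (scaledSeries ψ ρ 0) τ κ := by
  obtain ⟨κ, hκ, hlim⟩ := exists_tendsto_threeHalves_mul_A hψ hτ hρ
  have hτ0 := hτ.pos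
  have hv := value_pos hψ hτ.pos.le hτ.lt_radius
  have hρ0 : 0 < ρ := by rw [hρ]; positivity
  set f := scaledSeries ψ ρ 0 with hf
  have hnn : ∀ n, 0 ≤ PowerSeries.coeff n f := fun n => by
    rw [hf, coeff_scaledSeries]
    have := ABorder_nonneg hψ 0 n
    positivity
  have hmod : ∀ n, PowerSeries.coeff n f ≠ 0 → n ≡ 1 [MOD period ψ] := fun n hn => by
    rw [hf, coeff_scaledSeries, ABorder_zero_left] at hn
    exact A_modEq hψ (right_ne_zero_of_mul hn)
  obtain ⟨C, -, hC⟩ := exists_threeHalves_mul_le hmod hlim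
  have hS := summable_of_threeHalves_mul_le hnn (coeff_zero_scaledSeries ψ ρ 0) hC
  set s := ∑' n, PowerSeries.coeff n f with hs
  have hsτ : s ≤ τ := hS.tsum_le_of_sum_range_le fun N => sum_range_scaledSeries_le hψ hτ hρ N
  have hT : HasTail (period ψ) 1 f s κ := ⟨hnn, hmod, hS.hasSum, hlim⟩
  have hs0 := hT.sum_nonneg
  have hsr : ENNReal.ofReal s < radius ψ := (ENNReal.ofReal_le_ofReal hsτ).trans_lt hτ.lt_radius
  have hcomp := hT.comp (g := f) (ρ := ρ) (β := fun d => PowerSeries.coeff d ψ)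
    (coeff_zero_scaledSeries ψ ρ 0) hψ.coeff_nonneg (fun d => coeff_ne_zero_dvd hψ)
    (summable_coeff_mul_pow hψ hs0 hsr) (summable_coeff_mul_deriv_weight hψ hτ hs0 hsτ) hρ0.le
    (coeff_zero_scaledSeries ψ ρ 0) (fun n => by
      rw [hf, coeff_scaledSeries, ABorder_zero_left, A_succ, pow_succ', mul_assoc, Finset.mul_sum]
      congr 1
      refine Finset.sum_congr rfl fun d _ => ?_
      rw [coeff_scaledSeries_pow]
      ring)
  have hfix : s = ρ * value ψ s := by
    rw [value_real]
    exact hT.hasSum.unique hcomp.hasSum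
  have hsτ' : s = τ := by
    by_contra hne
    have h1 := lt_value_of_isApex hψ hτ hs0 hsr hne
    have h2 := mul_lt_mul_of_pos_left h1 hρ0
    rw [← hfix, hρ] at h2
    refine absurd h2 (not_lt.2 (le_of_eq ?_))
    field_simp
  exact ⟨κ, hκ, hsτ' ▸ hT⟩

end Compose

/-- The value at `(ρ, τ)` of `G_k`, as a real number. -/
noncomputable def iterValue (ψ : PowerSeries ℝ) (ρ τ : ℝ) : ℕ → ℝ
  | 0 => τ
  | k + 1 => ρ * (value ψ (iterValue ψ ρ τ k) - PowerSeries.coeff 0 ψ)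

/-- The derivative of `w ↦ G_k(ρ, w)` at `τ`, given by the chain rule. -/
noncomputable def iterDeriv (ψ : PowerSeries ℝ) (ρ τ : ℝ) : ℕ → ℝ
  | 0 => 1
  | k + 1 => ρ * (∑' d : ℕ, PowerSeries.coeff d ψ * (d * iterValue ψ ρ τ k ^ (d - 1))) *
      iterDeriv ψ ρ τ k

/-- The sum and the tail of the series of trees with `∂ ≥ k` are those of `G_k(z, T(z))`. -/
lemma exists_forall_hasTail_scaledSeries (hψ : IsK ψ) {τ ρ : ℝ} (hτ : IsApex ψ τ)
    (hρ : ρ = τ / value ψ τ) :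
    ∃ κ : ℝ, 0 < κ ∧ ∀ k, HasTail (period ψ) 1 (scaledSeries ψ ρ k) (iterValue ψ ρ τ k)
      (iterDeriv ψ ρ τ k * κ) := by
  obtain ⟨κ, hκ, h0⟩ := exists_hasTail_scaledSeries_zero hψ hτ hρ
  have hτ0 := hτ.pos
  have hv := value_pos hψ hτ.pos.le hτ.lt_radius
  have hρ0 : 0 < ρ := by rw [hρ]; positivity
  refine ⟨κ, hκ, fun k => ?_⟩
  induction k with
  | zero => simpa [iterValue, iterDeriv] using h0
  | succ k ih =>
    have hle : iterValue ψ ρ τ k ≤ τ := by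
      refine hasSum_le (fun n => ?_) ih.hasSum h0.hasSum
      rw [coeff_scaledSeries, coeff_scaledSeries, ABorder_zero_left]
      exact mul_le_mul_of_nonneg_left (ABorder_le hψ k n) (by positivity)
    rw [iterDeriv, mul_assoc _ (iterDeriv ψ ρ τ k)]
    exact ih.scaledSeries_succ hψ hτ hρ0.le hle

lemma iterValue_mem (hψ : IsK ψ) {τ ρ : ℝ} (hτ : IsApex ψ τ) (hρ : ρ = τ / value ψ τ) (k : ℕ) :
    0 ≤ iterValue ψ ρ τ k ∧ ENNReal.ofReal (iterValue ψ ρ τ k) < radius ψ := by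
  obtain ⟨κ, -, h⟩ := exists_forall_hasTail_scaledSeries hψ hτ hρ
  have hτ0 := hτ.pos
  have hv := value_pos hψ hτ.pos.le hτ.lt_radius
  have hρ0 : 0 < ρ := by rw [hρ]; positivity
  refine ⟨(h k).sum_nonneg, (ENNReal.ofReal_le_ofReal ?_).trans_lt hτ.lt_radius⟩
  refine hasSum_le (fun n => ?_) (h k).hasSum (h 0).hasSum
  rw [coeff_scaledSeries, coeff_scaledSeries, ABorder_zero_left]
  exact mul_le_mul_of_nonneg_left (ABorder_le hψ k n) (by positivity)

lemma hasDerivAt_GIter (hψ : IsK ψ) {τ ρ : ℝ} (hτ : IsApex ψ τ) (hρ : ρ = τ / value ψ τ) (k : ℕ) :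
    GIter ψ k (ρ : ℂ) (τ : ℂ) = (iterValue ψ ρ τ k : ℂ) ∧
    HasDerivAt (fun w : ℂ => GIter ψ k (ρ : ℂ) w) (iterDeriv ψ ρ τ k : ℂ) (τ : ℂ) := by
  induction k with
  | zero =>
    refine ⟨rfl, ?_⟩
    rw [iterDeriv, Complex.ofReal_one]
    exact hasDerivAt_id (τ : ℂ)
  | succ k ih =>
    obtain ⟨h1, h2⟩ := ih
    obtain ⟨h3, h4⟩ := iterValue_mem hψ hτ hρ k
    refine ⟨?_, ?_⟩
    · rw [GIter, G, h1, value_ofReal, iterValue]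
      push_cast
      rfl
    · have h5 := hasDerivAt_value hψ h3 h4
      rw [← h1] at h5
      have h6 := ((h5.comp (τ : ℂ) h2).sub_const
        ((PowerSeries.coeff 0 ψ : ℝ) : ℂ)).const_mul (ρ : ℂ)
      rw [iterDeriv, Complex.ofReal_mul, Complex.ofReal_mul, mul_assoc]
      exact h6

/-! ### Galton–Watson trees -/

lemma append_mem_treeOf (N : List ℕ → ℕ) (u : List ℕ) (i : ℕ) :
    u ++ [i] ∈ treeOf N ↔ u ∈ treeOf N ∧ i < N u := by
  constructor
  · intro h
    exact ⟨fun v j hv => h v j (hv.trans (List.prefix_append u [i])), h u i List.prefix_rfl⟩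
  · rintro ⟨h1, h2⟩ v j hv
    rcases List.prefix_concat_iff.1 hv with h | h
    · have := List.append_inj' h rfl
      simp only [List.cons.injEq, and_true] at this
      rw [this.1, this.2]
      exact h2
    · exact h1 v j h

lemma isPlaneTree_treeOf (N : List ℕ → ℕ) : IsPlaneTree (treeOf N) where
  root_mem := fun v i h => by simp at h
  parent_mem u i h := ((append_mem_treeOf N u i).1 h).1
  sibling_mem u i j hji h := by
    rw [append_mem_treeOf] at h ⊢
    exact ⟨h.1, hji.trans_lt h.2⟩

lemma outdegree_treeOf {N : List ℕ → ℕ} {u : List ℕ} (hu : u ∈ treeOf N) :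
    outdegree (treeOf N) u = N u := by
  have : {i : ℕ | u ++ [i] ∈ treeOf N} = Set.Iio (N u) := by
    ext i
    simp [append_mem_treeOf, hu]
  rw [outdegree, this, Set.ncard_Iio_nat]

/-- The Galton–Watson tree equals a given finite tree exactly when the offspring numbers of the
nodes of that tree are their outdegrees. -/
lemma treeOf_eq_iff {N : List ℕ → ℕ} {a : Finset (List ℕ)} (ha : IsPlaneTree (a : Set (List ℕ))) :
    treeOf N = (a : Set (List ℕ)) ↔ ∀ u ∈ a, N u = outdegree (a : Set (List ℕ)) u := by
  constructor
  · intro h u hu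
    rw [← h, outdegree_treeOf]
    rwa [h]
  · intro h
    ext u
    induction u using List.reverseRecOn with
    | nil => exact iff_of_true (isPlaneTree_treeOf N).root_mem ha.root_mem
    | append_singleton u i ih =>
      rw [append_mem_treeOf, ih]
      constructor
      · rintro ⟨h1, h2⟩
        rwa [ha.append_mem_iff a.finite_toSet, ← h u h1]
      · intro h1
        have h2 := ha.parent_mem u i h1
        exact ⟨h2, by rwa [h u h2, ← ha.append_mem_iff a.finite_toSet]⟩

/-- Every node but the root is a child of exactly one node. -/
lemma sum_outdegree {a : Finset (List ℕ)} (ha : IsPlaneTree (a : Set (List ℕ))) :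
    ∑ u ∈ a, outdegree (a : Set (List ℕ)) u + 1 = a.card := by
  rw [← Finset.card_erase_add_one (show [] ∈ a from ha.root_mem),
    Finset.card_eq_sum_card_fiberwise (f := List.dropLast) (s := a.erase []) (t := a)]
  · congr 1
    refine Finset.sum_congr rfl fun u _ => ?_
    have : (a.erase []).filter (fun v => v.dropLast = u) =
        (Finset.range (outdegree (a : Set (List ℕ)) u)).image (fun i => u ++ [i]) := by
      ext v
      simp only [Finset.mem_filter, Finset.mem_erase, Finset.mem_image, Finset.mem_range,
        ← ha.append_mem_iff a.finite_toSet]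
      constructor
      · rintro ⟨⟨h1, h2⟩, h3⟩
        have h4 := List.dropLast_append_getLast h1
        rw [h3] at h4
        exact ⟨v.getLast h1, by rw [h4]; exact h2, h4⟩
      · rintro ⟨i, hi, rfl⟩
        exact ⟨⟨by simp, hi⟩, by simp⟩
    rw [this, Finset.card_image_of_injective _ (fun i j h => by simpa using h), Finset.card_range]
  · intro v hv
    obtain ⟨h1, h2⟩ := Finset.mem_erase.1 hv
    rw [← List.dropLast_append_getLast h1] at h2
    exact ha.parent_mem _ _ h2

section Events

variable {Ω : Type*}

/-- The event that the Galton–Watson tree is the finite tree `a`. -/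
def treeEvent (N : List ℕ → Ω → ℕ) (a : Finset (List ℕ)) : Set Ω :=
  {ω | treeOf (fun u => N u ω) = (a : Set (List ℕ))}

lemma treeEvent_eq (N : List ℕ → Ω → ℕ) {a : Finset (List ℕ)}
    (ha : IsPlaneTree (a : Set (List ℕ))) :
    treeEvent N a = ⋂ u ∈ a, N u ⁻¹' {outdegree (a : Set (List ℕ)) u} := by
  ext ω
  simp [treeEvent, treeOf_eq_iff ha]

lemma sizeEvent_eq (N : List ℕ → Ω → ℕ) (n : ℕ) :
    sizeEvent N n = ⋃ a ∈ planeTrees n, treeEvent N a := by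
  ext ω
  simp only [sizeEvent, Set.mem_ofPred_eq, Set.mem_iUnion, treeEvent, mem_planeTrees, exists_prop]
  constructor
  · intro h
    have hfin : (treeOf fun u => N u ω).Finite := Set.finite_of_encard_eq_coe h
    refine ⟨hfin.toFinset, ⟨?_, ?_⟩, by simp⟩
    · rw [hfin.coe_toFinset]
      exact isPlaneTree_treeOf _
    · rw [hfin.encard_eq_coe_toFinset_card] at h
      exact_mod_cast h
  · rintro ⟨a, ⟨-, hc⟩, h⟩
    rw [h, Set.encard_coe_eq_coe_finsetCard, hc]

open Classical in
lemma sizeEvent_inter_borderEvent (N : List ℕ → Ω → ℕ) (n k : ℕ) :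
    sizeEvent N n ∩ borderEvent N k = ⋃ a ∈ (planeTrees n).filter
      (fun a : Finset (List ℕ) => (k : ℕ∞) ≤ borderDist (a : Set (List ℕ))), treeEvent N a := by
  rw [sizeEvent_eq]
  ext ω
  simp only [Set.mem_inter_iff, Set.mem_iUnion, exists_prop, Finset.mem_filter, treeEvent,
    borderEvent, Set.mem_ofPred_eq]
  constructor
  · rintro ⟨⟨a, ha, h⟩, hk⟩
    exact ⟨a, ⟨ha, h ▸ hk⟩, h⟩
  · rintro ⟨a, ⟨ha, hk⟩, h⟩
    exact ⟨⟨a, ha, h⟩, h ▸ hk⟩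

end Events

section Probability

variable {t : ℝ} {Ω : Type*} [MeasurableSpace Ω] {μ : Measure Ω} {N : List ℕ → Ω → ℕ}

lemma measurableSet_treeEvent (hN : IsKhinchinOffspring ψ t μ N) {a : Finset (List ℕ)}
    (ha : IsPlaneTree (a : Set (List ℕ))) : MeasurableSet (treeEvent N a) := by
  rw [treeEvent_eq N ha]
  exact a.measurableSet_biInter fun u _ => hN.measurable u (measurableSet_singleton _)

lemma measureReal_treeEvent (hN : IsKhinchinOffspring ψ t μ N) {n : ℕ} {a : Finset (List ℕ)}
    (ha : a ∈ planeTrees n) :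
    μ.real (treeEvent N a) = weight ψ a * (t ^ (n - 1) / value ψ t ^ n) := by
  obtain ⟨hT, hc⟩ := mem_planeTrees.1 ha
  have h1 := hN.indep.measure_inter_preimage_eq_mul (S := a)
    (sets := fun u => {outdegree (a : Set (List ℕ)) u}) (fun u _ => measurableSet_singleton _)
  have h2 : ∀ u, (μ (N u ⁻¹' {outdegree (a : Set (List ℕ)) u})).toReal =
      khinchinProb ψ t (outdegree (a : Set (List ℕ)) u) := fun u => hN.law u _
  rw [treeEvent_eq N hT, measureReal_def, h1, ENNReal.toReal_prod,
    Finset.prod_congr rfl fun u _ => h2 u]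
  simp only [khinchinProb]
  rw [Finset.prod_div_distrib, Finset.prod_mul_distrib, Finset.prod_const,
    Finset.prod_pow_eq_pow_sum, hc, weight, mul_div_assoc]
  congr 3
  have := sum_outdegree hT
  omega

/-- Conditionally on its size, the Galton–Watson tree has the law proportional to the weights: the
factor `t^{n-1} / ψ(t)ⁿ` depends on the number of nodes alone. -/
lemma measureReal_biUnion_treeEvent [IsProbabilityMeasure μ] (hN : IsKhinchinOffspring ψ t μ N)
    {n : ℕ} {S : Finset (Finset (List ℕ))} (hS : S ⊆ planeTrees n) :
    μ.real (⋃ a ∈ S, treeEvent N a) =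
      (∑ a ∈ S, weight ψ a) * (t ^ (n - 1) / value ψ t ^ n) := by
  rw [measureReal_biUnion_finset, Finset.sum_mul]
  · exact Finset.sum_congr rfl fun a ha => measureReal_treeEvent hN (hS ha)
  · intro a _ b _ hab
    refine Set.disjoint_left.2 fun ω h1 h2 => hab ?_
    exact Finset.coe_injective (Eq.trans (Eq.symm h1) h2)
  · exact fun a ha => measurableSet_treeEvent hN (mem_planeTrees.1 (hS ha)).1

lemma measureReal_sizeEvent [IsProbabilityMeasure μ] (hN : IsKhinchinOffspring ψ t μ N) (n : ℕ) :
    μ.real (sizeEvent N n) = A ψ n * (t ^ (n - 1) / value ψ t ^ n) := by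
  rw [sizeEvent_eq, measureReal_biUnion_treeEvent hN subset_rfl, A]

lemma measureReal_sizeEvent_inter [IsProbabilityMeasure μ] (hN : IsKhinchinOffspring ψ t μ N)
    (n k : ℕ) : μ.real (sizeEvent N n ∩ borderEvent N k) =
      ABorder ψ k n * (t ^ (n - 1) / value ψ t ^ n) := by
  rw [sizeEvent_inter_borderEvent, measureReal_biUnion_treeEvent hN (Finset.filter_subset _ _),
    ABorder]

lemma measurableSet_sizeEvent (hN : IsKhinchinOffspring ψ t μ N) (n : ℕ) :
    MeasurableSet (sizeEvent N n) := by
  rw [sizeEvent_eq]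
  exact Finset.measurableSet_biUnion _ fun a ha =>
    measurableSet_treeEvent hN (mem_planeTrees.1 ha).1

lemma sizeEvent_pos_iff (hψ : IsK ψ) (ht0 : 0 < t) (ht : ENNReal.ofReal t < radius ψ)
    [IsProbabilityMeasure μ] (hN : IsKhinchinOffspring ψ t μ N) (n : ℕ) :
    0 < μ (sizeEvent N n) ↔ 0 < A ψ n := by
  have hv := value_pos hψ ht0.le ht
  have h1 : 0 < μ (sizeEvent N n) ↔ 0 < μ.real (sizeEvent N n) := by
    rw [measureReal_def, ENNReal.toReal_pos_iff]
    exact ⟨fun h => ⟨h, measure_lt_top μ _⟩, fun h => h.1⟩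
  rw [h1, measureReal_sizeEvent hN, mul_pos_iff_of_pos_right (by positivity)]

lemma cond_borderEvent (hψ : IsK ψ) (ht0 : 0 < t) (ht : ENNReal.ofReal t < radius ψ)
    [IsProbabilityMeasure μ] (hN : IsKhinchinOffspring ψ t μ N) (n k : ℕ) :
    (cond μ (sizeEvent N n)).real (borderEvent N k) = ABorder ψ k n / A ψ n := by
  have hv := value_pos hψ ht0.le ht
  rw [measureReal_def, cond_apply (measurableSet_sizeEvent hN n), ENNReal.toReal_mul,
    ENNReal.toReal_inv, ← measureReal_def, ← measureReal_def, measureReal_sizeEvent hN,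
    measureReal_sizeEvent_inter hN, inv_mul_eq_div, mul_div_mul_right _ _ (by positivity)]

end Probability

/-- The tail constants of the tree series and of the series of trees with `∂ ≥ k` have the ratio
`∂G_k/∂w (ρ, τ)`. -/
lemma tendsto_ABorder_div_A (hψ : IsK ψ) {τ ρ : ℝ} (hτ : IsApex ψ τ)
    (hρ : ρ = τ / value ψ τ) (k : ℕ) :
    (∀ᶠ n in alongOne ψ, 0 < A ψ n) ∧
      Tendsto (fun n => ABorder ψ k n / A ψ n) (alongOne ψ) (𝓝 (iterDeriv ψ ρ τ k)) := by
  obtain ⟨κ, hκ, h⟩ := exists_forall_hasTail_scaledSeries hψ hτ hρ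
  have hτ0 := hτ.pos
  have hv := value_pos hψ hτ.pos.le hτ.lt_radius
  have hρ0 : 0 < ρ := by rw [hρ]; positivity
  have h0 := (h 0).tendsto
  have hk := (h k).tendsto
  rw [iterDeriv, one_mul] at h0
  have hpos : ∀ᶠ n in alongOne ψ, 0 < A ψ n := by
    refine (h0.eventually (lt_mem_nhds hκ)).mono fun n hn => ?_
    rw [coeff_scaledSeries, ABorder_zero_left] at hn
    refine lt_of_le_of_ne (A_nonneg hψ n) fun h => ?_
    rw [← h, mul_zero, mul_zero] at hn
    exact hn.ne rfl
  refine ⟨hpos, ?_⟩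
  have hdiv := hk.div h0 hκ.ne'
  rw [mul_div_cancel_right₀ _ hκ.ne'] at hdiv
  refine hdiv.congr' ?_
  filter_upwards [(eventually_gt_atTop 0).filter_mono (residueFilter_le_atTop (period ψ) 1)]
    with n hn
  have hw := threeHalves_pos hn
  rw [Pi.div_apply, coeff_scaledSeries, coeff_scaledSeries, ABorder_zero_left, ← mul_assoc,
    ← mul_assoc, mul_div_mul_left _ _ (by positivity)]

end GWBorder

theorem mainTheorem2 (ψ : PowerSeries ℝ) (hψ : GWBorder.IsKStar ψ) (k : ℕ) :
    (∃! τ : ℝ, GWBorder.IsApex ψ τ) ∧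
    ∀ τ : ℝ, GWBorder.IsApex ψ τ → ∀ ρ : ℝ, ρ = τ / GWBorder.value ψ τ →
      ∃ D : ℝ,
        -- `D` is the partial derivative of `G_k` with respect to `w` at `(ρ, τ)`
        HasDerivAt (fun w : ℂ => GWBorder.GIter ψ k (ρ : ℂ) w) (D : ℂ) (τ : ℂ) ∧
        (∀ᶠ n in GWBorder.alongOne ψ, 0 < GWBorder.A ψ n) ∧
        Tendsto (fun n => GWBorder.ABorder ψ k n / GWBorder.A ψ n)
          (GWBorder.alongOne ψ) (𝓝 D) ∧
        ∀ t : ℝ, 0 < t → ENNReal.ofReal t < GWBorder.radius ψ →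
          ∀ {Ω : Type*} [MeasurableSpace Ω] (μ : Measure Ω) [IsProbabilityMeasure μ]
            (N : List ℕ → Ω → ℕ), GWBorder.IsKhinchinOffspring ψ t μ N →
            (∀ᶠ n in GWBorder.alongOne ψ, 0 < μ (GWBorder.sizeEvent N n)) ∧
            (∀ n : ℕ, 0 < μ (GWBorder.sizeEvent N n) →
              0 < GWBorder.A ψ n ∧
              (cond μ (GWBorder.sizeEvent N n)).real (GWBorder.borderEvent N k) =
                GWBorder.ABorder ψ k n / GWBorder.A ψ n) ∧
            Tendsto
              (fun n => (cond μ (GWBorder.sizeEvent N n)).real (GWBorder.borderEvent N k))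
              (GWBorder.alongOne ψ) (𝓝 D) := by
  have hK := hψ.toIsK
  obtain ⟨τ₀, hτ₀⟩ := GWBorder.exists_isApex hψ
  refine ⟨⟨τ₀, hτ₀, fun τ hτ => GWBorder.isApex_unique hK hτ₀ hτ⟩, fun τ hτ ρ hρ => ?_⟩
  obtain ⟨hpos, hlim⟩ := GWBorder.tendsto_ABorder_div_A hK hτ hρ k
  refine ⟨GWBorder.iterDeriv ψ ρ τ k, (GWBorder.hasDerivAt_GIter hK hτ hρ k).2, hpos, hlim, ?_⟩
  intro t ht0 ht Ω _ μ _ N hN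
  refine ⟨hpos.mono fun n hn => (GWBorder.sizeEvent_pos_iff hK ht0 ht hN n).2 hn,
    fun n hn => ⟨(GWBorder.sizeEvent_pos_iff hK ht0 ht hN n).1 hn,
      GWBorder.cond_borderEvent hK ht0 ht hN n k⟩, ?_⟩
  exact hlim.congr fun n => (GWBorder.cond_borderEvent hK ht0 ht hN n k).symm
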